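/- Let $Q$ be a finite quiver (for example a Dynkin quiver) with vertex set $Q_0$ and arrow set $Q_1$, and let $\langle \mathbf d,\mathbf e\rangle=\sum_{i\in Q_0}d_ie_i-\sum_{(\alpha:i\to j)\in Q_1}d_ie_j$ be its Euler form. Let $P$ be a projective and $I$ an injective object of the category of finite-dimensional complex representations of $Q$, and let $\pi:P\oplus I\to P$ be the projection. For a finite-dimensional representation $M$ and a dimension vector $\mathbf e$, let $\mathrm{Gr}_{\mathbf e}(M)$ be the variety of subrepresentations of $M$ of dimension vector $\mathbf e$, a subvariety of $\prod_{i\in Q_0}\mathrm{Gr}_{e_i}(M_i)$. Let $\mathbf f,\mathbf g\in\mathbb Z_{\ge 0}Q_0$ with $\mathbf f+\mathbf g=\mathbf{dim}\,P$, and let $$\mathcal S_{\mathbf f}=\{N\in\mathrm{Gr}_{\mathbf{dim}\,P}(P\oplus I)\;:\;\mathbf{dim}\,(N\cap I)=\mathbf f,\ \mathbf{dim}\,\pi(N)=\mathbf g\},$$ with the structure of a subvariety of $\mathrm{Gr}_{\mathbf{dim}\,P}(P\oplus I)$. Then the map $$\zeta:\mathcal S_{\mathbf f}\to \mathrm{Gr}_{\mathbf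 g}(P)\times\mathrm{Gr}_{\mathbf f}(I),\qquad N\mapsto (N_P,N_I)=(\pi(N),\,N\cap I),$$ is surjective, and it is an algebraic vector bundle, locally trivial in the Zariski topology, whose fibre over $(N_P,N_I)$ is $\mathrm{Hom}_Q(N_P,I/N_I)$. More precisely: 1. For all $(N_P,N_I)\in \mathrm{Gr}_{\mathbf g}(P)\times\mathrm{Gr}_{\mathbf f}(I)$, the space $\mathrm{Hom}_Q(N_P,I/N_I)$ has dimension $D=\langle\mathbf{dim}\,P-\mathbf f,\ \mathbf{dim}\,I-\mathbf f\rangle$. 2. For all $(N_P,N_I)$ there is a bijection $\zeta^{-1}(N_P,N_I)\to\mathrm{Hom}_Q(N_P,I/N_I)$, $N\mapsto\varphi_N$, such that for all $i\in Q_0$, $p\in (N_P)_i$ and $x\in I_i$ one has $(p,x)\in N_i$ if and only if $\varphi_N(p)=x+(N_I)_i$. 3. The map $\zeta$ is a morphism of varieties, and every point of $\mathrm{Gr}_{\mathbf g}(P)\times\mathrm{Gr}_{\mathbf f}(I)$ has a Zariski-open neighbourhood $U$ with an isomorphism of varieties $\zeta^{-1}(U)\cong U\times\mathbb C^D$ over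 $U$ that restricts, for each $(N_P,N_I)\in U$, to a linear isomorphism $\mathrm{Hom}_Q(N_P,I/N_I)\cong\mathbb C^D$ on the fibre, identified as in 2. -/

import Mathlib

open scoped Topology

universe u v w

noncomputable section

theorem FunSpace.inter_open {X : Type*} {t : TopologicalSpace X} {U V : Set X} (hU : IsOpen[t] U)
    (hV : IsOpen[t] V) : IsOpen[t] (U ∩ V) :=
  @IsOpen.inter X t U V hU hV

/-! ## Spaces with functions over `ℂ` -/

/-- A space with functions over `ℂ`: a set `X` with a (Zariski) topology and, for every point `x`,
the set of complex functions that are regular in a neighbourhood of `x`.  A function is a section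
of the structure sheaf over an open set `U` iff it is regular at every point of `U`. The values of
the functions away from the neighbourhood in question are irrelevant (`reg_congr`). -/
structure FunSpace (X : Type*) where
  top : TopologicalSpace X
  RegAt : (X → ℂ) → X → Prop
  reg_congr : ∀ {f g : X → ℂ} {U : Set X} {x : X}, IsOpen[top] U → x ∈ U →
    (∀ y ∈ U, f y = g y) → RegAt f x → RegAt g x
  reg_nhd : ∀ {f : X → ℂ} {x : X}, RegAt f x → ∃ U, IsOpen[top] U ∧ x ∈ U ∧ ∀ y ∈ U, RegAt f y
  reg_const : ∀ (c : ℂ) (x : X), RegAt (fun _ => c) x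
  reg_add : ∀ {f g : X → ℂ} {x : X}, RegAt f x → RegAt g x → RegAt (f + g) x
  reg_mul : ∀ {f g : X → ℂ} {x : X}, RegAt f x → RegAt g x → RegAt (f * g) x
  reg_inv : ∀ {f : X → ℂ} {x : X}, RegAt f x → f x ≠ 0 → RegAt f⁻¹ x
  reg_ne : ∀ {f : X → ℂ} {x : X}, RegAt f x → f x ≠ 0 →
    ∃ U, IsOpen[top] U ∧ x ∈ U ∧ ∀ y ∈ U, f y ≠ 0

namespace FunSpace

variable {X Y : Type*}

/-- Morphisms: continuous maps that pull back regular functions to regular functions. -/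
structure IsMorphism (S : FunSpace X) (T : FunSpace Y) (φ : X → Y) : Prop where
  continuous : ∀ V, IsOpen[T.top] V → IsOpen[S.top] (φ ⁻¹' V)
  reg_comp : ∀ (g : Y → ℂ) (x : X), T.RegAt g (φ x) → S.RegAt (g ∘ φ) x

/-- Isomorphisms: bijections that are morphisms in both directions. -/
def IsIsomorphism (S : FunSpace X) (T : FunSpace Y) (φ : X ≃ Y) : Prop :=
  S.IsMorphism T φ ∧ T.IsMorphism S φ.symm

/-- The polynomial functions on a complex vector space. -/
def polyFun (E : Type*) [AddCommGroup E] [Module ℂ E] : Subalgebra ℂ (E → ℂ) :=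
  Algebra.adjoin ℂ {f | ∃ l : E →ₗ[ℂ] ℂ, f = l}

/-- A finite dimensional vector space as an affine variety: the Zariski topology has the sets
`{p ≠ 0}`, `p` polynomial, as a basis, and a function is regular at `x` if it is a
quotient `p / q` of polynomials near `x`. -/
def affine (E : Type*) [AddCommGroup E] [Module ℂ E] : FunSpace E where
  top := TopologicalSpace.generateFrom {U | ∃ p ∈ polyFun E, U = {x | p x ≠ 0}}
  RegAt f x := ∃ p ∈ polyFun E, ∃ q ∈ polyFun E, q x ≠ 0 ∧ ∃ U, IsOpen[TopologicalSpace.generateFrom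
    {U | ∃ p ∈ polyFun E, U = {x | p x ≠ 0}}] U ∧ x ∈ U ∧ ∀ y ∈ U, q y ≠ 0 ∧ f y = p y / q y
  reg_congr := by
    rintro f g U x hU hx hfg ⟨p, hp, q, hq, hqx, W, hW, hxW, h⟩
    exact ⟨p, hp, q, hq, hqx, W ∩ U, inter_open hW hU, ⟨hxW, hx⟩,
      fun y hy => ⟨(h y hy.1).1, by rw [← hfg y hy.2, (h y hy.1).2]⟩⟩
  reg_nhd := by
    rintro f x ⟨p, hp, q, hq, hqx, W, hW, hxW, h⟩
    exact ⟨W, hW, hxW, fun y hy => ⟨p, hp, q, hq, (h y hy).1, W, hW, hy, h⟩⟩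
  reg_const c x := ⟨algebraMap ℂ _ c, Subalgebra.algebraMap_mem _ c, 1, one_mem _, by simp,
    Set.univ, @isOpen_univ _ (_), trivial, fun y _ => by simp⟩
  reg_add := by
    rintro f g x ⟨p, hp, q, hq, hqx, W, hW, hxW, h⟩ ⟨p', hp', q', hq', hqx', W', hW', hxW', h'⟩
    refine ⟨p * q' + q * p', add_mem (mul_mem hp hq') (mul_mem hq hp'), q * q', mul_mem hq hq',
      mul_ne_zero hqx hqx', W ∩ W', inter_open hW hW', ⟨hxW, hxW'⟩, fun y hy =>
        ⟨mul_ne_zero (h y hy.1).1 (h' y hy.2).1, ?_⟩⟩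
    simp only [Pi.add_apply, Pi.mul_apply, (h y hy.1).2, (h' y hy.2).2]
    rw [div_add_div _ _ (h y hy.1).1 (h' y hy.2).1]
  reg_mul := by
    rintro f g x ⟨p, hp, q, hq, hqx, W, hW, hxW, h⟩ ⟨p', hp', q', hq', hqx', W', hW', hxW', h'⟩
    refine ⟨p * p', mul_mem hp hp', q * q', mul_mem hq hq',
      mul_ne_zero hqx hqx', W ∩ W', inter_open hW hW', ⟨hxW, hxW'⟩, fun y hy =>
        ⟨mul_ne_zero (h y hy.1).1 (h' y hy.2).1, ?_⟩⟩
    simp only [Pi.mul_apply, (h y hy.1).2, (h' y hy.2).2]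
    rw [div_mul_div_comm]
  reg_inv := by
    rintro f x ⟨p, hp, q, hq, hqx, W, hW, hxW, h⟩ hfx
    have hpx : p x ≠ 0 := by
      intro h0; apply hfx; rw [(h x hxW).2, h0, zero_div]
    refine ⟨q, hq, p, hp, hpx, W ∩ {y | p y ≠ 0},
      inter_open hW (TopologicalSpace.isOpen_generateFrom_of_mem ⟨p, hp, rfl⟩), ⟨hxW, hpx⟩,
      fun y hy => ⟨hy.2, ?_⟩⟩
    simp [(h y hy.1).2]
  reg_ne := by
    rintro f x ⟨p, hp, q, hq, hqx, W, hW, hxW, h⟩ hfx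
    have hpx : p x ≠ 0 := by
      intro h0; apply hfx; rw [(h x hxW).2, h0, zero_div]
    refine ⟨W ∩ {y | p y ≠ 0},
      inter_open hW (TopologicalSpace.isOpen_generateFrom_of_mem ⟨p, hp, rfl⟩), ⟨hxW, hpx⟩,
      fun y hy => ?_⟩
    rw [(h y hy.1).2]
    exact div_ne_zero hy.2 (h y hy.1).1

/-- The structure induced along a map `ι : X → Y` (used for inclusions): the induced topology, and
regular functions are locally the restrictions of regular functions. -/
def induced (ι : X → Y) (T : FunSpace Y) : FunSpace X where
  top := T.top.induced ι
  RegAt f x := ∃ g, T.RegAt g (ι x) ∧ ∃ U, IsOpen[T.top.induced ι] U ∧ x ∈ U ∧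
    ∀ y ∈ U, f y = g (ι y)
  reg_congr := by
    rintro f g U x hU hx hfg ⟨k, hk, W, hW, hxW, h⟩
    exact ⟨k, hk, W ∩ U, inter_open hW hU, ⟨hxW, hx⟩, fun y hy => by rw [← hfg y hy.2, h y hy.1]⟩
  reg_nhd := by
    rintro f x ⟨k, hk, W, hW, hxW, h⟩
    obtain ⟨O, hO, hxO, hOr⟩ := T.reg_nhd hk
    have hO' : IsOpen[T.top.induced ι] (ι ⁻¹' O) := ⟨O, hO, rfl⟩
    exact ⟨W ∩ ι ⁻¹' O, inter_open hW hO', ⟨hxW, hxO⟩, fun y hy => ⟨k, hOr _ hy.2, W, hW, hy.1, h⟩⟩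
  reg_const c x := ⟨fun _ => c, T.reg_const c _, Set.univ, @isOpen_univ _ (_), trivial,
    fun _ _ => rfl⟩
  reg_add := by
    rintro f g x ⟨k, hk, W, hW, hxW, h⟩ ⟨k', hk', W', hW', hxW', h'⟩
    exact ⟨k + k', T.reg_add hk hk', W ∩ W', inter_open hW hW', ⟨hxW, hxW'⟩, fun y hy => by
      simp [h y hy.1, h' y hy.2]⟩
  reg_mul := by
    rintro f g x ⟨k, hk, W, hW, hxW, h⟩ ⟨k', hk', W', hW', hxW', h'⟩
    exact ⟨k * k', T.reg_mul hk hk', W ∩ W', inter_open hW hW', ⟨hxW, hxW'⟩, fun y hy => by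
      simp [h y hy.1, h' y hy.2]⟩
  reg_inv := by
    rintro f x ⟨k, hk, W, hW, hxW, h⟩ hfx
    exact ⟨k⁻¹, T.reg_inv hk (by rwa [← h x hxW]), W, hW, hxW, fun y hy => by simp [h y hy]⟩
  reg_ne := by
    rintro f x ⟨k, hk, W, hW, hxW, h⟩ hfx
    obtain ⟨O, hO, hxO, hOr⟩ := T.reg_ne hk (by rwa [← h x hxW])
    have hO' : IsOpen[T.top.induced ι] (ι ⁻¹' O) := ⟨O, hO, rfl⟩
    exact ⟨W ∩ ι ⁻¹' O, inter_open hW hO', ⟨hxW, hxO⟩, fun y hy => by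
      rw [h y hy.1]; exact hOr _ hy.2⟩

/-- The quotient structure along a (surjective) map `π : X → Y`: a set is open iff its preimage
is, and a function is regular on an open set iff its pullback is. -/
def coinduced (π : X → Y) (S : FunSpace X) : FunSpace Y where
  top := S.top.coinduced π
  RegAt f y := ∃ U, IsOpen[S.top.coinduced π] U ∧ y ∈ U ∧ ∀ x, π x ∈ U → S.RegAt (f ∘ π) x
  reg_congr := by
    rintro f g U y hU hy hfg ⟨W, hW, hyW, h⟩
    exact ⟨W ∩ U, inter_open hW hU, ⟨hyW, hy⟩, fun x hx => S.reg_congr (U := π ⁻¹' U) hU hx.2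
      (fun z hz => hfg _ hz) (h x hx.1)⟩
  reg_nhd := by
    rintro f y ⟨W, hW, hyW, h⟩
    exact ⟨W, hW, hyW, fun z hz => ⟨W, hW, hz, h⟩⟩
  reg_const c y := ⟨Set.univ, @isOpen_univ _ (_), trivial, fun x _ => S.reg_const c x⟩
  reg_add := by
    rintro f g y ⟨W, hW, hyW, h⟩ ⟨W', hW', hyW', h'⟩
    exact ⟨W ∩ W', inter_open hW hW', ⟨hyW, hyW'⟩, fun x hx => S.reg_add (h x hx.1) (h' x hx.2)⟩
  reg_mul := by
    rintro f g y ⟨W, hW, hyW, h⟩ ⟨W', hW', hyW', h'⟩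
    exact ⟨W ∩ W', inter_open hW hW', ⟨hyW, hyW'⟩, fun x hx => S.reg_mul (h x hx.1) (h' x hx.2)⟩
  reg_inv := by
    rintro f y ⟨W, hW, hyW, h⟩ hfy
    refine ⟨W ∩ {z | f z ≠ 0}, ?_, ⟨hyW, hfy⟩, fun x hx => S.reg_inv (h x hx.1) hx.2⟩
    refine (@isOpen_iff_forall_mem_open _ S.top _).2 fun x hx => ?_
    obtain ⟨O, hO, hxO, hO'⟩ := S.reg_ne (h x hx.1) hx.2
    have hW' : IsOpen[S.top] (π ⁻¹' W) := hW
    exact ⟨π ⁻¹' W ∩ O, fun z hz => ⟨hz.1, hO' z hz.2⟩, inter_open hW' hO, hx.1, hxO⟩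
  reg_ne := by
    rintro f y ⟨W, hW, hyW, h⟩ hfy
    refine ⟨W ∩ {z | f z ≠ 0}, ?_, ⟨hyW, hfy⟩, fun x hx => hx.2⟩
    refine (@isOpen_iff_forall_mem_open _ S.top _).2 fun x hx => ?_
    obtain ⟨O, hO, hxO, hO'⟩ := S.reg_ne (h x hx.1) hx.2
    have hW' : IsOpen[S.top] (π ⁻¹' W) := hW
    exact ⟨π ⁻¹' W ∩ O, fun z hz => ⟨hz.1, hO' z hz.2⟩, inter_open hW' hO, hx.1, hxO⟩

/-- The functions `∑ₖ aₖ(x) bₖ(y)` with `aₖ` regular on `U` and `bₖ` regular on `V`. -/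
def tensorFun (S : FunSpace X) (T : FunSpace Y) (U : Set X) (V : Set Y) :
    Subalgebra ℂ (X × Y → ℂ) :=
  Algebra.adjoin ℂ ({h | ∃ a : X → ℂ, (∀ x ∈ U, S.RegAt a x) ∧ h = a ∘ Prod.fst} ∪
    {h | ∃ b : Y → ℂ, (∀ y ∈ V, T.RegAt b y) ∧ h = b ∘ Prod.snd})

theorem tensorFun_mono (S : FunSpace X) (T : FunSpace Y) {U U' : Set X} {V V' : Set Y}
    (hU : U' ⊆ U) (hV : V' ⊆ V) : tensorFun S T U V ≤ tensorFun S T U' V' := by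
  refine Algebra.adjoin_mono (Set.union_subset_union ?_ ?_)
  · rintro h ⟨a, ha, rfl⟩
    exact ⟨a, fun x hx => ha x (hU hx), rfl⟩
  · rintro h ⟨a, ha, rfl⟩
    exact ⟨a, fun x hx => ha x (hV hx), rfl⟩

/-- The topology of the product of two spaces with functions: a basis is given by the sets
`{(x, y) ∈ U × V | h (x, y) ≠ 0}` with `U`, `V` open and `h = ∑ₖ aₖ(x) bₖ(y)` regular on `U × V`.
For varieties this is the Zariski topology of the product variety. -/
@[reducible] def prodTop (S : FunSpace X) (T : FunSpace Y) : TopologicalSpace (X × Y) :=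
  TopologicalSpace.generateFrom {O | ∃ U V, IsOpen[S.top] U ∧ IsOpen[T.top] V ∧
    ∃ h ∈ tensorFun S T U V, O = {z | z.1 ∈ U ∧ z.2 ∈ V ∧ h z ≠ 0}}

theorem isOpen_prodTop (S : FunSpace X) (T : FunSpace Y) {U : Set X} {V : Set Y}
    (hU : IsOpen[S.top] U) (hV : IsOpen[T.top] V) {h : X × Y → ℂ} (hh : h ∈ tensorFun S T U V) :
    IsOpen[prodTop S T] {z | z.1 ∈ U ∧ z.2 ∈ V ∧ h z ≠ 0} :=
  TopologicalSpace.isOpen_generateFrom_of_mem ⟨U, V, hU, hV, h, hh, rfl⟩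

/-- The product in the category of spaces with functions; for varieties this is the product
variety. A function on the product is regular at a point if near this point it is a quotient of
two functions of the form `∑ₖ aₖ(x) bₖ(y)`. -/
def prod (S : FunSpace X) (T : FunSpace Y) : FunSpace (X × Y) where
  top := prodTop S T
  RegAt f z := ∃ U V, IsOpen[S.top] U ∧ IsOpen[T.top] V ∧
    ∃ p ∈ tensorFun S T U V, ∃ q ∈ tensorFun S T U V, ∃ O, IsOpen[prodTop S T] O ∧ z ∈ O ∧
      ∀ w ∈ O, w.1 ∈ U ∧ w.2 ∈ V ∧ q w ≠ 0 ∧ f w = p w / q w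
  reg_congr := by
    rintro f g W z hW hz hfg ⟨U, V, hU, hV, p, hp, q, hq, O, hO, hzO, h⟩
    exact ⟨U, V, hU, hV, p, hp, q, hq, O ∩ W, inter_open hO hW, ⟨hzO, hz⟩, fun w hw =>
      ⟨(h w hw.1).1, (h w hw.1).2.1, (h w hw.1).2.2.1, by
        rw [← hfg w hw.2, (h w hw.1).2.2.2]⟩⟩
  reg_nhd := by
    rintro f z ⟨U, V, hU, hV, p, hp, q, hq, O, hO, hzO, h⟩
    exact ⟨O, hO, hzO, fun w hw => ⟨U, V, hU, hV, p, hp, q, hq, O, hO, hw, h⟩⟩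
  reg_const c z := ⟨Set.univ, Set.univ, @isOpen_univ _ (_), @isOpen_univ _ (_),
    algebraMap ℂ _ c, Subalgebra.algebraMap_mem _ c, 1, one_mem _,
    Set.univ, @isOpen_univ _ (_), trivial, fun w _ => by simp⟩
  reg_add := by
    rintro f g z ⟨U, V, hU, hV, p, hp, q, hq, O, hO, hzO, h⟩
      ⟨U', V', hU', hV', p', hp', q', hq', O', hO', hzO', h'⟩
    have l := tensorFun_mono S T (Set.inter_subset_left (s := U) (t := U'))
      (Set.inter_subset_left (s := V) (t := V'))
    have r := tensorFun_mono S T (Set.inter_subset_right (s := U) (t := U'))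
      (Set.inter_subset_right (s := V) (t := V'))
    refine ⟨U ∩ U', V ∩ V', inter_open hU hU', inter_open hV hV',
      p * q' + q * p', add_mem (mul_mem (l hp) (r hq')) (mul_mem (l hq) (r hp')),
      q * q', mul_mem (l hq) (r hq'), O ∩ O', inter_open hO hO', ⟨hzO, hzO'⟩, fun w hw => ?_⟩
    obtain ⟨h1, h2, h3, h4⟩ := h w hw.1
    obtain ⟨h1', h2', h3', h4'⟩ := h' w hw.2
    refine ⟨⟨h1, h1'⟩, ⟨h2, h2'⟩, mul_ne_zero h3 h3', ?_⟩
    simp only [Pi.add_apply, Pi.mul_apply, h4, h4']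
    rw [div_add_div _ _ h3 h3']
  reg_mul := by
    rintro f g z ⟨U, V, hU, hV, p, hp, q, hq, O, hO, hzO, h⟩
      ⟨U', V', hU', hV', p', hp', q', hq', O', hO', hzO', h'⟩
    have l := tensorFun_mono S T (Set.inter_subset_left (s := U) (t := U'))
      (Set.inter_subset_left (s := V) (t := V'))
    have r := tensorFun_mono S T (Set.inter_subset_right (s := U) (t := U'))
      (Set.inter_subset_right (s := V) (t := V'))
    refine ⟨U ∩ U', V ∩ V', inter_open hU hU', inter_open hV hV',
      p * p', mul_mem (l hp) (r hp'),
      q * q', mul_mem (l hq) (r hq'), O ∩ O', inter_open hO hO', ⟨hzO, hzO'⟩, fun w hw => ?_⟩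
    obtain ⟨h1, h2, h3, h4⟩ := h w hw.1
    obtain ⟨h1', h2', h3', h4'⟩ := h' w hw.2
    refine ⟨⟨h1, h1'⟩, ⟨h2, h2'⟩, mul_ne_zero h3 h3', ?_⟩
    simp only [Pi.mul_apply, h4, h4']
    rw [div_mul_div_comm]
  reg_inv := by
    rintro f z ⟨U, V, hU, hV, p, hp, q, hq, O, hO, hzO, h⟩ hfz
    obtain ⟨h1, h2, h3, h4⟩ := h z hzO
    have hpz : p z ≠ 0 := by
      intro h0; apply hfz; rw [h4, h0, zero_div]
    refine ⟨U, V, hU, hV, q, hq, p, hp, _, inter_open hO (isOpen_prodTop S T hU hV hp),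
      ⟨hzO, h1, h2, hpz⟩, fun w hw => ⟨hw.2.1, hw.2.2.1, hw.2.2.2, ?_⟩⟩
    simp [(h w hw.1).2.2.2]
  reg_ne := by
    rintro f z ⟨U, V, hU, hV, p, hp, q, hq, O, hO, hzO, h⟩ hfz
    obtain ⟨h1, h2, h3, h4⟩ := h z hzO
    have hpz : p z ≠ 0 := by
      intro h0; apply hfz; rw [h4, h0, zero_div]
    refine ⟨_, inter_open hO (isOpen_prodTop S T hU hV hp), ⟨hzO, h1, h2, hpz⟩, fun w hw => ?_⟩
    rw [(h w hw.1).2.2.2]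
    exact div_ne_zero hw.2.2.2 (h w hw.1).2.2.1

/-- `ζ : E → B` is an algebraic vector bundle of rank `D`, locally trivial in the Zariski topology,
where the vector space structure of the fibre `ζ ⁻¹ (b)` is the one transported from the vector
space `F b` along the bijection `e b`: the map `ζ` is a morphism, and every
point of `B` has an open neighbourhood `U` with an isomorphism `Φ : ζ ⁻¹ (U) ≅ U × ℂ ^ D`
over `U` that is linear on each fibre. -/
def IsVectorBundle {E B : Type*} (SE : FunSpace E) (SB : FunSpace B) (ζ : E → B)
    (F : B → Type*) [∀ b, AddCommGroup (F b)] [∀ b, Module ℂ (F b)]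
    (e : ∀ b, {z : E // ζ z = b} ≃ F b) (D : ℕ) : Prop :=
  SE.IsMorphism SB ζ ∧
  ∀ b₀ : B, ∃ U : Set B, IsOpen[SB.top] U ∧ b₀ ∈ U ∧
    ∃ Φ : {z : E // ζ z ∈ U} ≃ {b : B // b ∈ U} × (Fin D → ℂ),
      (SE.induced Subtype.val).IsIsomorphism
        ((SB.induced Subtype.val).prod (affine (Fin D → ℂ))) Φ ∧
      (∀ z, ((Φ z).1 : B) = ζ z) ∧
      ∀ (b : B) (hb : b ∈ U), ∃ L : F b ≃ₗ[ℂ] (Fin D → ℂ),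
        ∀ z : {z : E // ζ z = b}, (Φ ⟨z.1, z.2.symm ▸ hb⟩).2 = L (e b z)

end FunSpace

/-! ## Quiver representations -/

/-- A finite dimensional complex representation of the quiver `V`. -/
structure QRep (V : Type v) [Quiver.{w} V] where
  obj : V → Type u
  [addCommGroup : ∀ i, AddCommGroup (obj i)]
  [module : ∀ i, Module ℂ (obj i)]
  [finite : ∀ i, Module.Finite ℂ (obj i)]
  map : ∀ {i j : V}, (i ⟶ j) → obj i →ₗ[ℂ] obj j

attribute [instance] QRep.addCommGroup QRep.module QRep.finite

namespace QRep

variable {V : Type v} [Quiver.{w} V]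

/-- The dimension vector. -/
def dim (M : QRep.{u} V) (i : V) : ℕ := Module.finrank ℂ (M.obj i)

/-- The Euler form of the quiver. -/
def euler [Fintype V] [∀ i j : V, Fintype (i ⟶ j)] (d e : V → ℤ) : ℤ :=
  ∑ i, d i * e i - ∑ i, ∑ j, ∑ _a : i ⟶ j, d i * e j

/-- The vector space `Hom_Q(M, N)`. -/
def hom (M N : QRep.{u} V) : Submodule ℂ (∀ i, M.obj i →ₗ[ℂ] N.obj i) where
  carrier := {φ | ∀ (i j : V) (a : i ⟶ j) (x : M.obj i), φ j (M.map a x) = N.map a (φ i x)}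
  add_mem' := by
    intro φ ψ hφ hψ i j a x
    simp [hφ i j a x, hψ i j a x]
  zero_mem' := by
    intro i j a x
    simp
  smul_mem' := by
    intro c φ hφ i j a x
    simp [hφ i j a x]

/-- `P` is a projective object of the category of finite dimensional representations. -/
def IsProjective (P : QRep.{u} V) : Prop :=
  ∀ (X Y : QRep.{u} V) (p : hom X Y) (φ : hom P Y), (∀ i, Function.Surjective (p.1 i)) →
    ∃ ψ : hom P X, ∀ i, p.1 i ∘ₗ ψ.1 i = φ.1 i

/-- `I` is an injective object of the category of finite dimensional representations. -/
def IsInjective (I : QRep.{u} V) : Prop :=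
  ∀ (X Y : QRep.{u} V) (m : hom X Y) (φ : hom X I), (∀ i, Function.Injective (m.1 i)) →
    ∃ ψ : hom Y I, ∀ i, ψ.1 i ∘ₗ m.1 i = φ.1 i

/-- The direct sum of two representations. -/
def sum (P I : QRep.{u} V) : QRep.{u} V where
  obj i := P.obj i × I.obj i
  map a := (P.map a).prodMap (I.map a)

/-- A subrepresentation. -/
structure Sub (M : QRep.{u} V) where
  space : ∀ i, Submodule ℂ (M.obj i)
  stable : ∀ {i j : V} (a : i ⟶ j), ∀ x ∈ space i, M.map a x ∈ space j

namespace Sub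

/-- A subrepresentation as a representation. -/
def toRep {M : QRep.{u} V} (N : Sub M) : QRep.{u} V where
  obj i := N.space i
  map a := (M.map a).restrict (N.stable a)

/-- The quotient representation `M / N`. -/
def quot {M : QRep.{u} V} (N : Sub M) : QRep.{u} V where
  obj i := M.obj i ⧸ N.space i
  map {i j} a := (N.space i).mapQ (N.space j) (M.map a) (N.stable a)

/-- `N_I = N ∩ I`, as a subrepresentation of `I`, for `N ⊆ P ⊕ I`. -/
def partI {P I : QRep.{u} V} (N : Sub (P.sum I)) : Sub I where
  space i := (N.space i).comap (LinearMap.inr ℂ (P.obj i) (I.obj i))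
  stable {i j} a x hx := by
    have h : (P.map a 0, I.map a x) ∈ N.space j := N.stable a _ hx
    rw [map_zero] at h
    exact h

/-- `N_P = π(N)`, for `N ⊆ P ⊕ I` and the projection `π : P ⊕ I → P`. -/
def partP {P I : QRep.{u} V} (N : Sub (P.sum I)) : Sub P where
  space i := (N.space i).map (LinearMap.fst ℂ (P.obj i) (I.obj i))
  stable {i j} a x hx := by
    obtain ⟨y, hy, rfl⟩ := hx
    exact ⟨_, N.stable a y hy, rfl⟩

end Sub

/-! ## Quiver Grassmannians -/

/-- The points of the product `∏ᵢ Gr_{eᵢ}(Mᵢ)` of Grassmannians. -/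
def GradedGr (e : V → ℕ) (M : QRep.{u} V) : Type (max u v) :=
  {U : ∀ i, Submodule ℂ (M.obj i) // ∀ i, Module.finrank ℂ (U i) = e i}

/-- Tuples of linearly independent families `Aᵢ` of `eᵢ` vectors of `Mᵢ`. -/
def Frame (e : V → ℕ) (M : QRep.{u} V) : Type (max u v) :=
  {A : ∀ i, Fin (e i) → M.obj i // ∀ i, LinearIndependent ℂ (A i)}

/-- The tuple of subspaces spanned by a tuple of linearly independent families. -/
def Frame.span {e : V → ℕ} {M : QRep.{u} V} (A : Frame e M) : GradedGr e M :=
  ⟨fun i => Submodule.span ℂ (Set.range (A.1 i)), fun i => by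
    rw [finrank_span_eq_card (A.2 i), Fintype.card_fin]⟩

/-- The variety `∏ᵢ Gr_{eᵢ}(Mᵢ)`, as the quotient by `∏ᵢ GL_{eᵢ}` of the open subvariety of tuples
of linearly independent families in the affine space `∏ᵢ Mᵢ ^ eᵢ`. -/
def GradedGr.funSpace (e : V → ℕ) (M : QRep.{u} V) : FunSpace (GradedGr e M) :=
  ((FunSpace.affine (∀ i, Fin (e i) → M.obj i)).induced
    (Subtype.val : Frame e M → ∀ i, Fin (e i) → M.obj i)).coinduced Frame.span

/-- The points of the quiver Grassmannian `Gr_e(M)`. -/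
def Gr (e : V → ℕ) (M : QRep.{u} V) : Type (max u v) :=
  {N : Sub M // ∀ i, Module.finrank ℂ (N.space i) = e i}

/-- The quiver Grassmannian as a subvariety of `∏ᵢ Gr_{eᵢ}(Mᵢ)`. -/
def Gr.funSpace (e : V → ℕ) (M : QRep.{u} V) : FunSpace (Gr e M) :=
  (GradedGr.funSpace e M).induced fun N => ⟨N.1.space, N.2⟩

/-- The stratum of all `N` in `Gr_{dim P}(P ⊕ I)` with `dim (N ∩ I) = f` and `dim π(N) = g`. -/
def Stratum (P I : QRep.{u} V) (f g : V → ℕ) : Type (max u v) :=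
  {N : Gr P.dim (P.sum I) // (∀ i, Module.finrank ℂ (N.1.partI.space i) = f i) ∧
    ∀ i, Module.finrank ℂ (N.1.partP.space i) = g i}

/-- The stratum as a subvariety of `Gr_{dim P}(P ⊕ I)`. -/
def Stratum.funSpace (P I : QRep.{u} V) (f g : V → ℕ) : FunSpace (Stratum P I f g) :=
  (Gr.funSpace P.dim (P.sum I)).induced Subtype.val

/-- The map `N ↦ (N_P, N_I)`. -/
def zeta (P I : QRep.{u} V) (f g : V → ℕ) (N : Stratum P I f g) : Gr g P × Gr f I :=
  (⟨N.1.1.partP, N.2.2⟩, ⟨N.1.1.partI, N.2.1⟩)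

end QRep

end

/-! A subrepresentation `N` of `P ⊕ I` with `π(N) = A` and `N ∩ I = B` is the graph of a relation
that becomes a homomorphism `A → I/B` modulo `B`, and every such homomorphism has a graph (`graph`,
`exists_graph_eq`). This identifies the fibres of `ζ`, and the zero homomorphism shows surjectivity.

The dimension of `Hom(A, I/B)` is constant because the obstruction space vanishes. `Hom` and `Ext`
are the kernel and cokernel of `homDiff`. Injectivity of `I` kills `Ext(M, I)`, and `Ext(M, I/B)` is
a quotient of it, since linear maps into `I/B` lift to `I` arrow by arrow. Hence `homDiff` is
surjective, and rank-nullity yields the Euler form.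

For local triviality, fix a point `(A₀, B₀)` and complements `WP`, `WI`. All nearby `A`, `B` are
still complementary to `WP`, `WI`, so a tuple of linear maps `A → I/B` is the same as a tuple `A₀ →
WI`, an element of a fixed vector space. There `Hom(A, I/B)` is the kernel of `chartDiff`, a linear
map depending regularly on `(A, B)`. Choose a linear map `L` to `ℂ^D` which together with
`chartDiff` is injective at the base point. Injectivity is an open condition, so `L` stays injective
on nearby kernels, and since these have dimension `D` it trivializes the bundle
(`isVectorBundle_zeta`).

Regularity always reduces to Cramer's rule (`exists_regular_inverse`): an injective linear system
with regular coefficients has regular solutions. This gives regular projections on Grassmannians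
(`GradedGr.regVecAt_projAlong`) and, conversely, morphisms into Grassmannians as images of regular
families of linear maps (`GradedGr.isMorphismAt_of_range`). -/

noncomputable section

/-! ### Germs of morphisms and the universal properties of induced, quotient and product structures
-/

namespace FunSpace

open Filter

variable {X Y Z : Type*}

/-- The neighbourhood filter of a point of a space with functions. -/
def nhd (S : FunSpace X) (x : X) : Filter X := @nhds X S.top x

theorem mem_nhd_of_isOpen {S : FunSpace X} {x : X} {U : Set X} (h : IsOpen[S.top] U) (hx : x ∈ U) :
    U ∈ S.nhd x :=
  letI := S.top; IsOpen.mem_nhds h hx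

theorem isOpen_of_nhd {S : FunSpace X} {U : Set X} (h : ∀ x ∈ U, U ∈ S.nhd x) : IsOpen[S.top] U :=
  (@isOpen_iff_mem_nhds X S.top U).2 h

theorem exists_isOpen_of_nhd {S : FunSpace X} {x : X} {U : Set X} (h : U ∈ S.nhd x) :
    ∃ O ⊆ U, IsOpen[S.top] O ∧ x ∈ O :=
  letI := S.top; mem_nhds_iff.1 h

theorem RegAt.congr {S : FunSpace X} {x : X} {f g : X → ℂ} (hf : S.RegAt f x)
    (h : ∀ᶠ y in S.nhd x, f y = g y) : S.RegAt g x := by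
  obtain ⟨O, hOU, hO, hx⟩ := exists_isOpen_of_nhd h
  exact S.reg_congr hO hx (fun y hy => hOU hy) hf

theorem RegAt.eventually_ne {S : FunSpace X} {x : X} {f : X → ℂ} (hf : S.RegAt f x)
    (h : f x ≠ 0) : ∀ᶠ y in S.nhd x, f y ≠ 0 := by
  obtain ⟨O, hO, hx, hne⟩ := S.reg_ne hf h
  exact mem_of_superset (mem_nhd_of_isOpen hO hx) hne

/-- The functions that are regular at a point. -/
def regAlg (S : FunSpace X) (x : X) : Subalgebra ℂ (X → ℂ) where
  carrier := {f | S.RegAt f x}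
  mul_mem' hf hg := S.reg_mul hf hg
  add_mem' hf hg := S.reg_add hf hg
  algebraMap_mem' c := S.reg_const c x

/-- Morphisms of germs. -/
structure IsMorphismAt (S : FunSpace X) (T : FunSpace Y) (φ : X → Y) (x : X) : Prop where
  tendsto : Tendsto φ (S.nhd x) (T.nhd (φ x))
  reg_comp : ∀ g : Y → ℂ, T.RegAt g (φ x) → S.RegAt (g ∘ φ) x

theorem isMorphism_iff {S : FunSpace X} {T : FunSpace Y} {φ : X → Y} :
    S.IsMorphism T φ ↔ ∀ x, S.IsMorphismAt T φ x := by
  constructor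
  · intro h x
    refine ⟨?_, fun g => h.reg_comp g x⟩
    exact (@continuous_iff_continuousAt X Y S.top T.top φ).1
      ((@continuous_def X Y S.top T.top φ).2 h.continuous) x
  · intro h
    refine ⟨?_, fun g x => (h x).reg_comp g⟩
    exact (@continuous_def X Y S.top T.top φ).1
      ((@continuous_iff_continuousAt X Y S.top T.top φ).2 fun x => (h x).tendsto)

theorem IsMorphismAt.comp {S : FunSpace X} {T : FunSpace Y} {R : FunSpace Z} {φ : X → Y}
    {ψ : Y → Z} {x : X} (hψ : T.IsMorphismAt R ψ (φ x)) (hφ : S.IsMorphismAt T φ x) :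
    S.IsMorphismAt R (ψ ∘ φ) x :=
  ⟨hψ.tendsto.comp hφ.tendsto, fun g hg => hφ.reg_comp _ (hψ.reg_comp g hg)⟩

theorem nhd_induced (ι : X → Y) (T : FunSpace Y) (x : X) :
    (T.induced ι).nhd x = comap ι (T.nhd (ι x)) :=
  letI := T.top; nhds_induced ι x

theorem isMorphismAt_induced (ι : X → Y) (T : FunSpace Y) (x : X) :
    (T.induced ι).IsMorphismAt T ι x :=
  ⟨by rw [nhd_induced]; exact tendsto_comap,
    fun g hg => ⟨g, hg, Set.univ, @isOpen_univ _ (_), trivial, fun _ _ => rfl⟩⟩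

theorem isMorphismAt_to_induced {S : FunSpace X} {T : FunSpace Z} {ι : Y → Z} {φ : X → Y} {x : X}
    (h : S.IsMorphismAt T (ι ∘ φ) x) : S.IsMorphismAt (T.induced ι) φ x := by
  have ht : Tendsto φ (S.nhd x) ((T.induced ι).nhd (φ x)) := by
    rw [nhd_induced, tendsto_comap_iff]
    exact h.tendsto
  refine ⟨ht, ?_⟩
  rintro g ⟨k, hk, U, hU, hxU, hg⟩
  refine (h.reg_comp k hk).congr ?_
  filter_upwards [ht (mem_nhd_of_isOpen (S := T.induced ι) hU hxU)] with y hy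
  exact (hg _ hy).symm

theorem isMorphismAt_coinduced {S : FunSpace X} (π : X → Y) (x : X) :
    S.IsMorphismAt (S.coinduced π) π x := by
  refine ⟨@Continuous.continuousAt _ _ S.top (S.top.coinduced π) π x
    (letI := S.top; continuous_coinduced_rng), ?_⟩
  rintro g ⟨U, hU, hx, h⟩
  exact h x hx

theorem isMorphismAt_fst (S : FunSpace X) (T : FunSpace Y) (z : X × Y) :
    (S.prod T).IsMorphismAt S Prod.fst z := by
  have key : ∀ U, IsOpen[S.top] U → IsOpen[(S.prod T).top] (Prod.fst ⁻¹' U) := fun U hU => by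
    have := isOpen_prodTop S T hU (@isOpen_univ _ T.top) (one_mem (tensorFun S T U Set.univ))
    simp only [Set.mem_univ, Pi.one_apply, ne_eq, one_ne_zero, not_false_eq_true,
      and_true] at this
    exact this
  refine ⟨@Continuous.continuousAt _ _ (S.prod T).top S.top _ z
    ((@continuous_def _ _ (S.prod T).top S.top _).2 key), fun g hg => ?_⟩
  obtain ⟨U, hU, hx, hr⟩ := S.reg_nhd hg
  exact ⟨U, Set.univ, hU, @isOpen_univ _ T.top, g ∘ Prod.fst,
    Algebra.subset_adjoin (Or.inl ⟨g, hr, rfl⟩), 1, one_mem _, _, key U hU, hx,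
    fun w hw => ⟨hw, trivial, by simp⟩⟩

theorem isMorphismAt_snd (S : FunSpace X) (T : FunSpace Y) (z : X × Y) :
    (S.prod T).IsMorphismAt T Prod.snd z := by
  have key : ∀ U, IsOpen[T.top] U → IsOpen[(S.prod T).top] (Prod.snd ⁻¹' U) := fun U hU => by
    have := isOpen_prodTop S T (@isOpen_univ _ S.top) hU (one_mem (tensorFun S T Set.univ U))
    simp only [Set.mem_univ, true_and, Pi.one_apply, ne_eq, one_ne_zero, not_false_eq_true,
      and_true] at this
    exact this
  refine ⟨@Continuous.continuousAt _ _ (S.prod T).top T.top _ z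
    ((@continuous_def _ _ (S.prod T).top T.top _).2 key), fun g hg => ?_⟩
  obtain ⟨U, hU, hx, hr⟩ := T.reg_nhd hg
  exact ⟨Set.univ, U, @isOpen_univ _ S.top, hU, g ∘ Prod.snd,
    Algebra.subset_adjoin (Or.inr ⟨g, hr, rfl⟩), 1, one_mem _, _, key U hU, hx,
    fun w hw => ⟨trivial, hw, by simp⟩⟩

theorem regAt_comp_of_mem_adjoin {S : FunSpace X} {φ : X → Y} {x : X} {s : Set (Y → ℂ)}
    (hs : ∀ p ∈ s, S.RegAt (p ∘ φ) x) {p : Y → ℂ} (hp : p ∈ Algebra.adjoin ℂ s) :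
    S.RegAt (p ∘ φ) x := by
  induction hp using Algebra.adjoin_induction with
  | mem p hp => exact hs p hp
  | algebraMap c => exact S.reg_const c x
  | add p q _ _ hp hq => exact S.reg_add hp hq
  | mul p q _ _ hp hq => exact S.reg_mul hp hq

theorem RegAt.div {S : FunSpace X} {x : X} {f g : X → ℂ} (hf : S.RegAt f x) (hg : S.RegAt g x)
    (h : g x ≠ 0) : S.RegAt (fun y => f y / g y) x := by
  have : S.RegAt (fun y => f y * (g y)⁻¹) x := S.reg_mul hf (S.reg_inv hg h)
  simpa only [div_eq_mul_inv] using this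

theorem RegAt.sum {S : FunSpace X} {x : X} {ι : Type*} {s : Finset ι} {f : ι → X → ℂ}
    (h : ∀ i ∈ s, S.RegAt (f i) x) : S.RegAt (fun y => ∑ i ∈ s, f i y) x := by
  have : S.RegAt (∑ i ∈ s, f i) x := sum_mem (S := S.regAlg x) h
  convert this using 1
  ext y
  simp

/-- Functions in `tensorFun` are polynomial in pullbacks from the two factors, so they pull back to
regular functions. The basic open sets are their nonvanishing loci, which gives continuity, and
regular functions are their quotients. -/
theorem isMorphismAt_prod {S : FunSpace X} {T : FunSpace Y} {R : FunSpace Z} {φ : X → Y × Z}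
    {x : X} (h₁ : S.IsMorphismAt T (fun y => (φ y).1) x)
    (h₂ : S.IsMorphismAt R (fun y => (φ y).2) x) : S.IsMorphismAt (T.prod R) φ x := by
  have hreg : ∀ U V, (φ x).1 ∈ U → (φ x).2 ∈ V → ∀ p ∈ tensorFun T R U V,
      S.RegAt (p ∘ φ) x := by
    intro U V hxU hxV p hp
    refine regAt_comp_of_mem_adjoin ?_ hp
    rintro _ (⟨a, ha, rfl⟩ | ⟨a, ha, rfl⟩)
    · exact h₁.reg_comp a (ha _ hxU)
    · exact h₂.reg_comp a (ha _ hxV)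
  have ht : Tendsto φ (S.nhd x) ((T.prod R).nhd (φ x)) := by
    refine TopologicalSpace.tendsto_nhds_generateFrom_iff.2 ?_
    rintro _ ⟨U, V, hU, hV, p, hp, rfl⟩ ⟨hxU, hxV, hne⟩
    filter_upwards [h₁.tendsto (mem_nhd_of_isOpen hU hxU), h₂.tendsto (mem_nhd_of_isOpen hV hxV),
      (hreg U V hxU hxV p hp).eventually_ne hne] with y h1 h2 h3
    exact ⟨h1, h2, h3⟩
  refine ⟨ht, ?_⟩
  rintro g ⟨U, V, hU, hV, p, hp, q, hq, O, hO, hz, h⟩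
  obtain ⟨hxU, hxV, hne, -⟩ := h _ hz
  refine ((hreg U V hxU hxV p hp).div (hreg U V hxU hxV q hq) hne).congr ?_
  filter_upwards [ht (mem_nhd_of_isOpen (S := T.prod R) hO hz)] with y hy
  exact (h _ hy).2.2.2.symm

/-! ### Regular functions with values in a vector space -/

section Affine

variable {E F : Type*} [AddCommGroup E] [Module ℂ E] [AddCommGroup F] [Module ℂ F]

/-- Regularity at a point of a function with values in a vector space. -/
def RegVecAt (S : FunSpace X) (φ : X → E) (x : X) : Prop :=
  ∀ l : E →ₗ[ℂ] ℂ, S.RegAt (fun y => l (φ y)) x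

/-- Linear forms generate the polynomial functions, so they suffice as tests. Continuity is
automatic, because the nonvanishing of a regular function is an open condition. -/
theorem isMorphismAt_affine {S : FunSpace X} {φ : X → E} {x : X} :
    S.IsMorphismAt (affine E) φ x ↔ S.RegVecAt φ x := by
  constructor
  · intro h l
    exact h.reg_comp l ⟨l, Algebra.subset_adjoin ⟨l, rfl⟩, 1, one_mem _, by simp, Set.univ,
      @isOpen_univ _ (_), trivial, fun _ _ => by simp⟩
  intro h
  have hreg : ∀ p ∈ polyFun E, S.RegAt (p ∘ φ) x := by
    intro p hp
    refine regAt_comp_of_mem_adjoin ?_ hp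
    rintro _ ⟨l, rfl⟩
    exact h l
  have ht : Tendsto φ (S.nhd x) ((affine E).nhd (φ x)) := by
    refine TopologicalSpace.tendsto_nhds_generateFrom_iff.2 ?_
    rintro _ ⟨p, hp, rfl⟩ hne
    exact (hreg p hp).eventually_ne hne
  refine ⟨ht, ?_⟩
  rintro g ⟨p, hp, q, hq, hne, O, hO, hx, hg⟩
  refine ((hreg p hp).div (hreg q hq) hne).congr ?_
  filter_upwards [ht (mem_nhd_of_isOpen (S := affine E) hO hx)] with y hy
  exact (hg _ hy).2.symm

theorem regVecAt_id (x : E) : (affine E).RegVecAt id x :=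
  isMorphismAt_affine.1 ⟨tendsto_id, fun _ h => h⟩

theorem regVecAt_const (S : FunSpace X) (v : E) (x : X) : S.RegVecAt (fun _ => v) x :=
  fun l => S.reg_const (l v) x

namespace RegVecAt

variable {S : FunSpace X} {x : X}

theorem congr {φ ψ : X → E} (hφ : S.RegVecAt φ x) (h : ∀ᶠ y in S.nhd x, φ y = ψ y) :
    S.RegVecAt ψ x :=
  fun l => (hφ l).congr (h.mono fun y hy => by rw [hy])

theorem comp {T : FunSpace Y} {φ : Y → E} {ψ : X → Y} (hφ : T.RegVecAt φ (ψ x))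
    (hψ : S.IsMorphismAt T ψ x) : S.RegVecAt (fun y => φ (ψ y)) x :=
  fun l => hψ.reg_comp _ (hφ l)

theorem add {φ ψ : X → E} (hφ : S.RegVecAt φ x) (hψ : S.RegVecAt ψ x) :
    S.RegVecAt (fun y => φ y + ψ y) x := fun l => by
  simp only [map_add]
  exact S.reg_add (hφ l) (hψ l)

theorem map {φ : X → E} (hφ : S.RegVecAt φ x) (J : E →ₗ[ℂ] F) :
    S.RegVecAt (fun y => J (φ y)) x :=
  fun l => hφ (l ∘ₗ J)

theorem neg {φ : X → E} (hφ : S.RegVecAt φ x) : S.RegVecAt (fun y => -φ y) x := by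
  simpa using hφ.map (-LinearMap.id)

theorem sub {φ ψ : X → E} (hφ : S.RegVecAt φ x) (hψ : S.RegVecAt ψ x) :
    S.RegVecAt (fun y => φ y - ψ y) x := by
  simpa only [sub_eq_add_neg] using hφ.add hψ.neg

theorem smul {c : X → ℂ} {φ : X → E} (hc : S.RegAt c x) (hφ : S.RegVecAt φ x) :
    S.RegVecAt (fun y => c y • φ y) x := fun l => by
  simp only [map_smul]
  exact S.reg_mul hc (hφ l)

theorem sum {ι : Type*} {s : Finset ι} {φ : ι → X → E} (h : ∀ i ∈ s, S.RegVecAt (φ i) x) :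
    S.RegVecAt (fun y => ∑ i ∈ s, φ i y) x := fun l => by
  simp only [map_sum]
  exact RegAt.sum fun i hi => h i hi l

theorem of_injective {φ : X → E} (J : E →ₗ[ℂ] F) (hJ : Function.Injective J)
    (h : S.RegVecAt (fun y => J (φ y)) x) : S.RegVecAt φ x := by
  obtain ⟨G, hG⟩ := J.exists_leftInverse_of_injective (LinearMap.ker_eq_bot.2 hJ)
  have := h.map G
  simpa only [← LinearMap.comp_apply, hG, LinearMap.id_apply] using this

theorem prodMk {φ : X → E} {ψ : X → F} (hφ : S.RegVecAt φ x) (hψ : S.RegVecAt ψ x) :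
    S.RegVecAt (fun y => (φ y, ψ y)) x := by
  simpa using (hφ.map (LinearMap.inl ℂ E F)).add (hψ.map (LinearMap.inr ℂ E F))

theorem pi {ι : Type*} [Finite ι] {E : ι → Type*} [∀ i, AddCommGroup (E i)] [∀ i, Module ℂ (E i)]
    {φ : X → ∀ i, E i} (h : ∀ i, S.RegVecAt (fun y => φ y i) x) : S.RegVecAt φ x := by
  classical
  have := Fintype.ofFinite ι
  have := RegVecAt.sum (s := Finset.univ) fun i _ => (h i).map (LinearMap.single ℂ E i)
  convert this using 1
  ext y i
  simp [Finset.sum_apply]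

theorem linearMap [FiniteDimensional ℂ E] {φ : X → E →ₗ[ℂ] F}
    (h : ∀ v, S.RegVecAt (fun y => φ y v) x) : S.RegVecAt φ x := by
  let b := Module.finBasis ℂ E
  refine of_injective (b.constr ℂ (M' := F)).symm.toLinearMap (LinearEquiv.injective _) (pi ?_)
  intro i
  simpa [Module.Basis.constr] using h (b i)

end RegVecAt

/-! ### Linear systems with regular coefficients -/

section Solve

variable {S : FunSpace X} {x : X} [FiniteDimensional ℂ E] {A : X → E →ₗ[ℂ] F}

/-- Cramer's rule. Composing with a constant left inverse `G` of `A x` makes the system square, with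
value the identity at `x`. Its determinant is therefore nonzero near `x`, and adjugate over
determinant, composed with `G`, is the required left inverse. -/
theorem exists_regular_inverse (hA : ∀ v, S.RegVecAt (fun y => A y v) x)
    (hx : Function.Injective (A x)) :
    ∃ G : X → F →ₗ[ℂ] E, (∀ v, S.RegVecAt (fun y => G y v) x) ∧
      ∀ᶠ y in S.nhd x, G y ∘ₗ A y = LinearMap.id := by
  obtain ⟨G, hG⟩ := (A x).exists_leftInverse_of_injective (LinearMap.ker_eq_bot.2 hx)
  let b := Module.finBasis ℂ E
  let M : X → Matrix _ _ ℂ := fun y => LinearMap.toMatrix b b (G ∘ₗ A y)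
  -- The same matrix over the ring of functions regular at `x`: its determinant and adjugate lie in
  -- that ring, and evaluation at `y` commutes with forming them.
  let N : Matrix (Fin (Module.finrank ℂ E)) (Fin (Module.finrank ℂ E)) (S.regAlg x) :=
    fun i j => ⟨fun y => M y i j, by
      have := hA (b j) (b.coord i ∘ₗ G)
      change S.RegAt _ x
      simpa [M, LinearMap.toMatrix_apply] using this⟩
  let ev : ∀ y : X, S.regAlg x →+* ℂ := fun y => (Pi.evalRingHom _ y).comp (S.regAlg x).val.toRingHom
  have hMN : ∀ y, M y = (ev y).mapMatrix N := fun y => by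
    ext i j; rfl
  have hdet : S.RegAt (fun y => (M y).det) x := by
    have : S.RegAt N.det.1 x := N.det.2
    convert this using 1
    ext y
    rw [hMN, ← RingHom.map_det]
    rfl
  have hadj : ∀ i j, S.RegAt (fun y => (M y).adjugate i j) x := fun i j => by
    have : S.RegAt (N.adjugate i j).1 x := (N.adjugate i j).2
    convert this using 1
    ext y
    rw [hMN, ← RingHom.map_adjugate]
    rfl
  have hdx : (M x).det ≠ 0 := by
    simp [M, hG]
  refine ⟨fun y => ((M y).det)⁻¹ • (Matrix.toLin b b (M y).adjugate ∘ₗ G), fun v => ?_, ?_⟩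
  · simp only [LinearMap.smul_apply, LinearMap.comp_apply, Matrix.toLin_apply]
    refine RegVecAt.smul (S.reg_inv hdet hdx) (RegVecAt.sum fun i _ =>
      RegVecAt.smul ?_ (regVecAt_const _ _ _))
    simp only [Matrix.mulVec, dotProduct]
    exact RegAt.sum (f := fun j y => (M y).adjugate i j * b.repr (G v) j)
      fun j _ => S.reg_mul (hadj i j) (S.reg_const _ x)
  · filter_upwards [hdet.eventually_ne hdx] with y hy
    have h1 : G ∘ₗ A y = Matrix.toLin b b (M y) := by simp [M]
    rw [LinearMap.smul_comp, LinearMap.comp_assoc, h1, ← Matrix.toLin_mul, Matrix.adjugate_mul,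
      map_smul, Matrix.toLin_one, smul_smul, inv_mul_cancel₀ hy, one_smul]

theorem eventually_injective (hA : ∀ v, S.RegVecAt (fun y => A y v) x)
    (hx : Function.Injective (A x)) : ∀ᶠ y in S.nhd x, Function.Injective (A y) := by
  obtain ⟨G, -, hG⟩ := exists_regular_inverse hA hx
  filter_upwards [hG] with y hy
  exact Function.LeftInverse.injective (g := G y) fun v => LinearMap.congr_fun hy v

theorem RegVecAt.apply {G : X → E →ₗ[ℂ] F} {φ : X → E} (hG : ∀ v, S.RegVecAt (fun y => G y v) x)
    (hφ : S.RegVecAt φ x) : S.RegVecAt (fun y => G y (φ y)) x := by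
  let b := Module.finBasis ℂ E
  have := RegVecAt.sum (s := Finset.univ) fun i _ => RegVecAt.smul (hφ (b.coord i)) (hG (b i))
  convert this using 1
  ext y
  conv_lhs => rw [← b.sum_repr (φ y), map_sum]
  simp

/-- The solution of a linear system with regular coefficients is regular. -/
theorem RegVecAt.of_apply [FiniteDimensional ℂ F] {φ : X → E} {ψ : X → F}
    (hA : ∀ v, S.RegVecAt (fun y => A y v) x)
    (hx : Function.Injective (A x)) (hψ : S.RegVecAt ψ x)
    (h : ∀ᶠ y in S.nhd x, A y (φ y) = ψ y) : S.RegVecAt φ x := by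
  obtain ⟨G, hGr, hG⟩ := exists_regular_inverse hA hx
  refine (RegVecAt.apply hGr hψ).congr ?_
  filter_upwards [hG, h] with y hy h
  rw [← h]
  exact LinearMap.congr_fun hy _

end Solve

end Affine

end FunSpace

/-! ### Projections along a varying subspace -/

section ProjAlong

variable {M : Type*} [AddCommGroup M] [Module ℂ M]

open Classical in
/-- The projection onto `W` along `N`, or `0` if these are not complementary. -/
def projAlong (W N : Submodule ℂ M) : M →ₗ[ℂ] M :=
  if h : IsCompl W N then W.projection N h else 0

variable {W N : Submodule ℂ M}

theorem projAlong_mem (h : IsCompl W N) (x : M) : projAlong W N x ∈ W := by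
  rw [projAlong, dif_pos h]
  exact Submodule.projection_apply_mem h x

theorem sub_projAlong_mem (h : IsCompl W N) (x : M) : x - projAlong W N x ∈ N := by
  rw [projAlong, dif_pos h]
  exact Submodule.sub_projection_mem h x

theorem projAlong_eq_iff (h : IsCompl W N) {x w : M} :
    projAlong W N x = w ↔ w ∈ W ∧ x - w ∈ N := by
  constructor
  · rintro rfl
    exact ⟨projAlong_mem h x, sub_projAlong_mem h x⟩
  · rintro ⟨hw, hN⟩
    rw [← sub_eq_zero]
    refine Submodule.disjoint_def.1 h.disjoint _ (sub_mem (projAlong_mem h x) hw) ?_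
    simpa using sub_mem hN (sub_projAlong_mem h x)

/-- The linear system whose solution is the decomposition of a vector with respect to `W` and the
span of a family `v`. -/
def coprodFamily (W : Submodule ℂ M) {n : ℕ} (v : Fin n → M) : (Fin n → ℂ) × W →ₗ[ℂ] M :=
  (Fintype.linearCombination ℂ v).coprod W.subtype

theorem coprodFamily_injective_iff [FiniteDimensional ℂ M] {n : ℕ} {v : Fin n → M}
    (hv : LinearIndependent ℂ v) (hW : Module.finrank ℂ M = Module.finrank ℂ W + n) :
    Function.Injective (coprodFamily W v) ↔ IsCompl W (Submodule.span ℂ (Set.range v)) := by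
  rw [Submodule.isCompl_iff_disjoint _ _ (by
    rw [finrank_span_eq_card hv, Fintype.card_fin, hW]), Submodule.disjoint_def]
  constructor
  · intro h x hx hv
    rw [← Fintype.range_linearCombination] at hv
    obtain ⟨t, rfl⟩ := hv
    have : coprodFamily W v (t, 0) = coprodFamily W v (0, ⟨_, hx⟩) := by simp [coprodFamily]
    have := h this
    simp only [Prod.mk.injEq] at this
    simp [this.1]
  · intro h
    rw [← LinearMap.ker_eq_bot, LinearMap.ker_eq_bot']
    rintro ⟨t, w⟩ ht
    simp only [coprodFamily, LinearMap.coprod_apply, Submodule.subtype_apply] at ht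
    have h1 : Fintype.linearCombination ℂ v t ∈ Submodule.span ℂ (Set.range v) := by
      rw [← Fintype.range_linearCombination]
      exact ⟨t, rfl⟩
    have hw : (w : M) = 0 := h _ w.2 (by
      rw [eq_neg_of_add_eq_zero_right ht]
      exact neg_mem h1)
    rw [hw, add_zero, Fintype.linearCombination_apply] at ht
    have := Fintype.linearIndependent_iff.1 hv t ht
    ext1
    · ext i
      exact this i
    · exact Subtype.ext hw

end ProjAlong

/-! ### Local coordinates on products of Grassmannians -/

namespace QRep

open FunSpace Filter

variable {V : Type v} [Quiver.{w} V] {e : V → ℕ} {M : QRep.{u} V}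

/-- The variety of tuples of linearly independent families. -/
def Frame.funSpace (e : V → ℕ) (M : QRep.{u} V) : FunSpace (Frame e M) :=
  (FunSpace.affine (∀ i, Fin (e i) → M.obj i)).induced Subtype.val

theorem Frame.regVecAt (A : Frame e M) (i : V) (k : Fin (e i)) :
    (Frame.funSpace e M).RegVecAt (fun A => A.1 i k) A :=
  RegVecAt.comp (φ := fun B : ∀ i, Fin (e i) → M.obj i => B i k)
    ((regVecAt_id A.1).map ((LinearMap.proj k).comp (LinearMap.proj i :
      (∀ i, Fin (e i) → M.obj i) →ₗ[ℂ] (Fin (e i) → M.obj i))))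
    (isMorphismAt_induced _ _ _)

theorem Frame.isMorphismAt_span (A : Frame e M) :
    (Frame.funSpace e M).IsMorphismAt (GradedGr.funSpace e M) Frame.span A :=
  isMorphismAt_coinduced _ _

theorem Frame.regVecAt_coprodFamily (A : Frame e M) (i : V) (W : Submodule ℂ (M.obj i))
    (t : (Fin (e i) → ℂ) × W) :
    (Frame.funSpace e M).RegVecAt (fun A => coprodFamily W (A.1 i) t) A := by
  simp only [coprodFamily, LinearMap.coprod_apply, Fintype.linearCombination_apply]
  exact (RegVecAt.sum fun k _ => RegVecAt.smul (reg_const _ _ _) (A.regVecAt i k)).add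
    (regVecAt_const _ _ _)

theorem Frame.coprodFamily_injective_iff (A : Frame e M) {i : V} {W : Submodule ℂ (M.obj i)}
    (hW : Module.finrank ℂ (M.obj i) = Module.finrank ℂ W + e i) :
    Function.Injective (coprodFamily W (A.1 i)) ↔ IsCompl W (A.span.1 i) :=
  _root_.coprodFamily_injective_iff (A.2 i) hW

theorem GradedGr.finrank_eq (N : GradedGr e M) {i : V} {W : Submodule ℂ (M.obj i)}
    (h : IsCompl W (N.1 i)) : Module.finrank ℂ (M.obj i) = Module.finrank ℂ W + e i := by
  rw [← Submodule.finrank_add_eq_of_isCompl h, N.2 i]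

theorem Frame.span_surjective : Function.Surjective (Frame.span : Frame e M → GradedGr e M) := by
  intro N
  let b := fun i => Module.finBasisOfFinrankEq ℂ (N.1 i) (N.2 i)
  refine ⟨⟨fun i k => b i k, fun i => (b i).linearIndependent.map' (N.1 i).subtype
    (N.1 i).ker_subtype⟩, Subtype.ext (funext fun i => ?_)⟩
  have := congr_arg (Submodule.map (N.1 i).subtype) (b i).span_eq
  rw [Submodule.map_span, ← Set.range_comp, Submodule.map_subtype_top] at this
  exact this

/-- Openness in the quotient topology is tested on frames, where complementarity to `W` is the
injectivity of a linear map with regular coefficients. -/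
theorem GradedGr.isOpen_isCompl (i : V) (W : Submodule ℂ (M.obj i)) :
    IsOpen[(GradedGr.funSpace e M).top] {N | IsCompl W (N.1 i)} := by
  change IsOpen[(Frame.funSpace e M).top] (Frame.span ⁻¹' {N | IsCompl W (N.1 i)})
  refine isOpen_of_nhd fun A hA => ?_
  have hW := A.span.finrank_eq hA
  filter_upwards [eventually_injective (fun t => A.regVecAt_coprodFamily i W t)
    ((A.coprodFamily_injective_iff hW).2 hA)] with B hB
  exact (B.coprodFamily_injective_iff hW).1 hB

theorem GradedGr.eventually_isCompl [Finite V] (N : GradedGr e M) {W : ∀ i, Submodule ℂ (M.obj i)}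
    (h : ∀ i, IsCompl (W i) (N.1 i)) :
    ∀ᶠ N' in (GradedGr.funSpace e M).nhd N, ∀ i, IsCompl (W i) (N'.1 i) :=
  eventually_all.2 fun i => mem_nhd_of_isOpen (GradedGr.isOpen_isCompl i (W i)) (h i)

/-- These projections play the role of affine coordinates on the chart of complements of `W`. On
frames, the projection of `x` is the `W`-component of the solution of a linear system with regular
coefficients. -/
theorem GradedGr.regVecAt_projAlong (N : GradedGr e M) {i : V} {W : Submodule ℂ (M.obj i)}
    (h : IsCompl W (N.1 i)) (x : M.obj i) :
    (GradedGr.funSpace e M).RegVecAt (fun N' => projAlong W (N'.1 i) x) N := by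
  intro l
  refine ⟨_, GradedGr.isOpen_isCompl i W, h, fun A hA => ?_⟩
  have hW := N.finrank_eq h
  have hinj := (A.coprodFamily_injective_iff hW).2 hA
  have hev : ∀ᶠ B in (Frame.funSpace e M).nhd A, IsCompl W (B.span.1 i) :=
    (A.isMorphismAt_span).tendsto (mem_nhd_of_isOpen (GradedGr.isOpen_isCompl i W) hA)
  have hsol : ∀ B : Frame e M, IsCompl W (B.span.1 i) → ∃ t, coprodFamily W (B.1 i) t = x := by
    intro B hB
    have hmem : x - projAlong W (B.span.1 i) x ∈ Submodule.span ℂ (Set.range (B.1 i)) :=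
      sub_projAlong_mem hB x
    rw [← Fintype.range_linearCombination] at hmem
    obtain ⟨t, ht⟩ := hmem
    exact ⟨(t, ⟨_, projAlong_mem hB x⟩), by simp [coprodFamily, ht]⟩
  have hr : (Frame.funSpace e M).RegVecAt
      (fun B => Function.invFun (coprodFamily W (B.1 i)) x) A :=
    RegVecAt.of_apply (fun t => A.regVecAt_coprodFamily i W t) hinj (regVecAt_const _ x A)
      (hev.mono fun B hB => Function.invFun_eq (hsol B hB))
  refine ((hr.map (W.subtype ∘ₗ LinearMap.snd ℂ _ _)).congr ?_) l
  filter_upwards [hev] with B hB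
  symm
  refine (projAlong_eq_iff hB).2 ⟨Submodule.coe_mem _, ?_⟩
  have h1 := Function.invFun_eq (hsol B hB)
  generalize Function.invFun (coprodFamily W (B.1 i)) x = s at h1 ⊢
  have h2 : x - (W.subtype ∘ₗ LinearMap.snd ℂ _ _) s = Fintype.linearCombination ℂ (B.1 i) s.1 :=
    sub_eq_of_eq_add h1.symm
  change _ ∈ Submodule.span ℂ (Set.range (B.1 i))
  rw [← Fintype.range_linearCombination, h2]
  exact ⟨_, rfl⟩

/-- A map into a product of Grassmannians is a morphism near a point if it is given as the image
of injective linear maps with regular coefficients. -/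
theorem GradedGr.isMorphismAt_of_range [Finite V] {Z : Type*} {S : FunSpace Z} {z : Z}
    {φ : Z → GradedGr e M} {E : V → Type*} [∀ i, AddCommGroup (E i)] [∀ i, Module ℂ (E i)]
    [∀ i, FiniteDimensional ℂ (E i)] (hE : ∀ i, Module.finrank ℂ (E i) = e i)
    {G : Z → ∀ i, E i →ₗ[ℂ] M.obj i} (hG : ∀ i x, S.RegVecAt (fun y => G y i x) z)
    (h : ∀ᶠ y in S.nhd z, ∀ i, LinearMap.range (G y i) = (φ y).1 i) :
    S.IsMorphismAt (GradedGr.funSpace e M) φ z := by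
  classical
  let b := fun i => Module.finBasisOfFinrankEq ℂ (E i) (hE i)
  have hspan : ∀ y i, LinearMap.range (G y i) = (φ y).1 i →
      Submodule.span ℂ (Set.range fun k => G y i (b i k)) = (φ y).1 i := by
    intro y i hy
    rw [← hy, ← Submodule.map_top, ← (b i).span_eq, Submodule.map_span, ← Set.range_comp]
    rfl
  -- A lift of `φ` to frames. Where the ranges do not match, any frame will do: only the germ at `z`
  -- has to be regular, but `Frame.span ∘ F = φ` is wanted everywhere.
  have hF : ∀ y, ∃ A : Frame e M, A.span = φ y ∧
      ((∀ i, LinearMap.range (G y i) = (φ y).1 i) → A.1 = fun i k => G y i (b i k)) := by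
    intro y
    by_cases hy : ∀ i, LinearMap.range (G y i) = (φ y).1 i
    · refine ⟨⟨fun i k => G y i (b i k), fun i => ?_⟩, Subtype.ext (funext fun i => ?_), fun _ => rfl⟩
      · rw [linearIndependent_iff_card_eq_finrank_span, Set.finrank, hspan y i (hy i), (φ y).2 i,
          Fintype.card_fin]
      · exact hspan y i (hy i)
    · obtain ⟨A, hA⟩ := Frame.span_surjective (φ y)
      exact ⟨A, hA, fun h => absurd h hy⟩
  choose F hFs hFe using hF
  have hFm : S.IsMorphismAt (Frame.funSpace e M) F z := by
    refine isMorphismAt_to_induced (isMorphismAt_affine.2 ?_)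
    refine RegVecAt.congr (φ := fun y i k => G y i (b i k))
      (RegVecAt.pi fun i => RegVecAt.pi fun k => hG i (b i k)) ?_
    filter_upwards [h] with y hy
    exact (hFe y hy).symm
  have := (F z).isMorphismAt_span.comp hFm
  rwa [show Frame.span ∘ F = φ from funext hFs] at this

end QRep

/-! ### Vanishing of extensions and the dimension of Hom -/

namespace QRep

variable {V : Type v} [Quiver.{w} V]

/-- The map `∏ᵢ Hom(Mᵢ, Nᵢ) → ∏ₐ Hom(Mᵢ, Nⱼ)` whose kernel is `Hom_Q(M, N)` and whose cokernel is
`Ext_Q(M, N)`. -/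
def homDiff (M N : QRep.{u} V) : (∀ i, M.obj i →ₗ[ℂ] N.obj i) →ₗ[ℂ]
    ∀ i j : V, (i ⟶ j) → M.obj i →ₗ[ℂ] N.obj j where
  toFun h i j a := h j ∘ₗ M.map a - N.map a ∘ₗ h i
  map_add' h h' := by
    ext i j a x
    simp
    abel
  map_smul' c h := by
    ext i j a x
    simp [smul_sub]

theorem ker_homDiff (M N : QRep.{u} V) : LinearMap.ker (homDiff M N) = hom M N := by
  ext h
  simp only [LinearMap.mem_ker, homDiff, LinearMap.coe_mk, AddHom.coe_mk, funext_iff,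
    LinearMap.ext_iff, hom, Submodule.mem_mk]
  exact forall_congr' fun i => forall_congr' fun j => forall_congr' fun a =>
    forall_congr' fun x => sub_eq_zero

/-- The extension of `M` by `N` given by a cocycle. -/
def extension (M N : QRep.{u} V) (c : ∀ i j : V, (i ⟶ j) → M.obj i →ₗ[ℂ] N.obj j) :
    QRep.{u} V where
  obj i := N.obj i × M.obj i
  map {i j} a := ((N.map a).coprod (c i j a)).prod (M.map a ∘ₗ LinearMap.snd ℂ _ _)

/-- This is `Ext(M, I) = 0`. A cocycle defines an extension of `M` by `I`; the identity of `I`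
extends to a retraction of it, whose `M`-component exhibits the cocycle as a coboundary. -/
theorem homDiff_surjective_of_isInjective (M : QRep.{u} V) {I : QRep.{u} V} (hI : I.IsInjective) :
    Function.Surjective (homDiff M I) := by
  intro c
  obtain ⟨ψ, hψ⟩ := hI I (extension M I c)
    ⟨fun i => LinearMap.inl ℂ (I.obj i) (M.obj i), fun i j a x => by
      change (I.map a x, (0 : M.obj j)) = (I.map a x + c i j a 0, M.map a 0)
      simp⟩
    ⟨fun i => LinearMap.id, fun i j a x => rfl⟩ (fun i => LinearMap.inl_injective)
  let Ψ : ∀ i, I.obj i × M.obj i →ₗ[ℂ] I.obj i := ψ.1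
  have h1 : ∀ i x, Ψ i (x, 0) = x := fun i x => LinearMap.congr_fun (hψ i) x
  let h : ∀ i, M.obj i →ₗ[ℂ] I.obj i := fun i => Ψ i ∘ₗ LinearMap.inr ℂ (I.obj i) (M.obj i)
  -- Compatibility of the retraction with an arrow reads `c + h ∘ M.map a = I.map a ∘ h`, so the
  -- coboundary of `h` is `-c`.
  refine ⟨-h, ?_⟩
  ext i j a y
  have h2 : Ψ j (I.map a 0 + c i j a y, M.map a y) = I.map a (h i y) := ψ.2 i j a (0, y)
  have h3 : Ψ j (I.map a 0 + c i j a y, M.map a y) = c i j a y + h j (M.map a y) := by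
    have : (I.map a 0 + c i j a y, M.map a y) = (c i j a y, (0 : M.obj j)) + (0, M.map a y) := by
      simp
    rw [this, map_add, h1]
    rfl
  rw [h3] at h2
  simp only [homDiff, LinearMap.coe_mk, AddHom.coe_mk, LinearMap.sub_apply, LinearMap.comp_apply,
    Pi.neg_apply, LinearMap.neg_apply, map_neg, ← h2]
  abel

/-- A cocycle is a family of linear maps subject to no condition, so it lifts from `I/B` to `I`.
There it is a coboundary, and coboundaries push forward to coboundaries. -/
theorem homDiff_quot_surjective (M : QRep.{u} V) {I : QRep.{u} V} (hI : I.IsInjective)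
    (B : Sub I) : Function.Surjective (homDiff M B.quot) := by
  intro c
  have hc : ∀ i j (a : i ⟶ j), ∃ c' : M.obj i →ₗ[ℂ] I.obj j, (B.space j).mkQ ∘ₗ c' = c i j a := by
    intro i j a
    exact Module.projective_lifting_property _ _ (Submodule.mkQ_surjective _)
  choose c' hc' using hc
  obtain ⟨h, hh⟩ := homDiff_surjective_of_isInjective M hI c'
  refine ⟨fun i => (B.space i).mkQ ∘ₗ h i, ?_⟩
  funext i j a
  rw [← hc', ← hh]
  ext x
  simp only [homDiff, LinearMap.coe_mk, AddHom.coe_mk, LinearMap.sub_apply, LinearMap.comp_apply]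
  rfl

theorem finrank_hom_of_homDiff_surjective [Fintype V] [∀ i j : V, Fintype (i ⟶ j)]
    {M N : QRep.{u} V} (h : Function.Surjective (homDiff M N)) :
    (Module.finrank ℂ (hom M N) : ℤ) = euler (fun i => (M.dim i : ℤ)) (fun i => (N.dim i : ℤ)) := by
  have := (homDiff M N).finrank_range_add_finrank_ker
  rw [ker_homDiff, LinearMap.range_eq_top.2 h, finrank_top] at this
  simp only [Module.finrank_pi_fintype, Module.finrank_linearMap] at this
  rw [euler, eq_sub_iff_add_eq']
  exact_mod_cast this

theorem finrank_hom_sub_quot [Fintype V] [∀ i j : V, Fintype (i ⟶ j)]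
    {P I : QRep.{u} V} (hI : I.IsInjective) (A : Sub P) (B : Sub I) :
    (Module.finrank ℂ (hom A.toRep B.quot) : ℤ) =
      euler (fun i => (Module.finrank ℂ (A.space i) : ℤ))
        (fun i => (I.dim i : ℤ) - Module.finrank ℂ (B.space i)) := by
  rw [finrank_hom_of_homDiff_surjective (homDiff_quot_surjective _ hI B)]
  congr 1
  ext i
  rw [eq_sub_iff_add_eq]
  exact_mod_cast (B.space i).finrank_quotient_add_finrank

/-! ### The subrepresentations of `P ⊕ I` with given intersection and projection -/

section Graph

variable {P I : QRep.{u} V}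

theorem Sub.ext {M : QRep.{u} V} {N N' : Sub M} (h : ∀ i x, x ∈ N.space i ↔ x ∈ N'.space i) :
    N = N' := by
  cases N
  cases N'
  congr
  ext i x
  exact h i x

/-- The subrepresentation of all `(p, x)` with `φ(p) = x + B`. -/
def graph (A : Sub P) (B : Sub I) (φ : hom A.toRep B.quot) : Sub (P.sum I) where
  space i :=
    { carrier := {z | ∃ p : A.space i, p = z.1 ∧ φ.1 i p = Submodule.Quotient.mk z.2}
      add_mem' := by
        rintro z z' ⟨p, hp, hφ⟩ ⟨p', hp', hφ'⟩
        refine ⟨p + p', congr_arg₂ (· + ·) hp hp', ?_⟩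
        have := (φ.1 i).map_add p p'
        rw [hφ, hφ'] at this
        exact this
      zero_mem' := ⟨0, rfl, (φ.1 i).map_zero⟩
      smul_mem' := by
        rintro c z ⟨p, hp, hφ⟩
        refine ⟨c • p, congr_arg (c • ·) hp, ?_⟩
        have := (φ.1 i).map_smul c p
        rw [hφ] at this
        exact this }
  stable {i j} a := by
    rintro z ⟨p, hp, hφ⟩
    refine ⟨⟨P.map a p, A.stable a p p.2⟩, congr_arg (P.map a) hp, ?_⟩
    have := φ.2 i j a p
    rw [hφ] at this
    exact this

variable {A : Sub P} {B : Sub I} {φ : hom A.toRep B.quot}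

theorem mk_mem_graph {i : V} {p : A.space i} {x : I.obj i} :
    ((p : P.obj i), x) ∈ (graph A B φ).space i ↔ φ.1 i p = Submodule.Quotient.mk x :=
  ⟨fun ⟨q, hq, h⟩ => by rwa [Subtype.ext hq] at h, fun h => ⟨p, rfl, h⟩⟩

theorem graph_partP : (graph A B φ).partP = A := by
  refine Sub.ext fun i p => ⟨?_, fun hp => ?_⟩
  · rintro ⟨z, ⟨q, hq, -⟩, rfl⟩
    change z.1 ∈ A.space i
    exact hq ▸ q.2
  · obtain ⟨x, hx⟩ := Submodule.Quotient.mk_surjective _ (φ.1 i ⟨p, hp⟩)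
    exact ⟨(p, x), ⟨⟨p, hp⟩, rfl, hx.symm⟩, rfl⟩

theorem graph_partI : (graph A B φ).partI = B := by
  refine Sub.ext fun i x => ?_
  change (((0 : A.space i) : P.obj i), x) ∈ (graph A B φ).space i ↔ _
  rw [mk_mem_graph]
  have h0 : φ.1 i (0 : A.space i) = (0 : I.obj i ⧸ B.space i) := (φ.1 i).map_zero
  refine (Eq.congr_left h0).trans (eq_comm.trans ?_)
  exact Submodule.Quotient.mk_eq_zero _

theorem graph_injective : Function.Injective (graph A B) := by
  intro φ ψ h
  ext i p
  obtain ⟨x, hx⟩ := Submodule.Quotient.mk_surjective _ (φ.1 i p)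
  rw [← hx]
  exact (mk_mem_graph.1 (h ▸ mk_mem_graph.2 hx.symm)).symm

theorem exists_graph_eq (N : Sub (P.sum I)) : ∃ φ, graph N.partP N.partI φ = N := by
  let σ : ∀ i, N.space i →ₗ[ℂ] N.partP.space i := fun i =>
    (LinearMap.fst ℂ (P.obj i) (I.obj i)).restrict fun z hz => ⟨z, hz, rfl⟩
  have hσ : ∀ i, LinearMap.range (σ i) = ⊤ := by
    intro i
    refine LinearMap.range_eq_top.2 ?_
    rintro ⟨_, z, hz, rfl⟩
    exact ⟨⟨z, hz⟩, rfl⟩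
  choose s hs using fun i => (σ i).exists_rightInverse_of_surjective (hσ i)
  let φ : ∀ i, N.partP.space i →ₗ[ℂ] I.obj i ⧸ N.partI.space i := fun i =>
    (N.partI.space i).mkQ ∘ₗ LinearMap.snd ℂ (P.obj i) (I.obj i) ∘ₗ (N.space i).subtype ∘ₗ s i
  have hs1 : ∀ i p, (s i p).1.1 = p := fun i p => congr_arg Subtype.val (LinearMap.congr_fun (hs i) p)
  -- The linear sections `s i` need not commute with the arrows. This description of `φ` does not
  -- involve `s`, and compatibility with the arrows follows from it and the stability of `N`.
  have key : ∀ i (p : N.partP.space i) (x : I.obj i),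
      φ i p = Submodule.Quotient.mk x ↔ ((p : P.obj i), x) ∈ N.space i := by
    intro i p x
    change Submodule.Quotient.mk (s i p).1.2 = _ ↔ _
    rw [Submodule.Quotient.eq]
    change ((0 : P.obj i), (s i p).1.2 - x) ∈ N.space i ↔ _
    let n : P.obj i × I.obj i := (s i p).1
    have h0 : ((0 : P.obj i), (s i p).1.2 - x) = n - ((p : P.obj i), x) := by
      rw [← hs1 i p]
      exact Prod.ext (sub_self _).symm rfl
    rw [h0]
    exact Submodule.sub_mem_iff_right _ (s i p).2
  have hφ : φ ∈ hom N.partP.toRep N.partI.quot := by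
    intro i j a (p : N.partP.space i)
    have h1 : ((p : P.obj i), (s i p).1.2) ∈ N.space i := by
      rw [← hs1 i p]
      exact (s i p).2
    exact (key j ⟨P.map a p, N.partP.stable a _ p.2⟩ (I.map a (s i p).1.2)).2 (N.stable a _ h1)
  refine ⟨⟨φ, hφ⟩, Sub.ext fun i z => ⟨?_, fun hz => ?_⟩⟩
  · rintro ⟨p, hp, h⟩
    have := (key i p z.2).1 h
    rwa [hp] at this
  · have h1 : z.1 ∈ N.partP.space i := ⟨z, hz, rfl⟩
    exact ⟨⟨z.1, h1⟩, rfl, (key i ⟨z.1, h1⟩ z.2).2 hz⟩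

/-- Rank-nullity for the first projection restricted to `N`, whose kernel is a copy of `N ∩ I`. -/
theorem finrank_partP_add_finrank_partI (N : Sub (P.sum I)) (i : V) :
    Module.finrank ℂ (N.partP.space i) + Module.finrank ℂ (N.partI.space i) =
      Module.finrank ℂ (N.space i) := by
  let S : Submodule ℂ (P.obj i × I.obj i) := N.space i
  let σ := (LinearMap.fst ℂ (P.obj i) (I.obj i)).domRestrict S
  have h := σ.finrank_range_add_finrank_ker
  change _ = Module.finrank ℂ S
  rw [← h]
  congr 1
  · rw [LinearMap.range_domRestrict]
    rfl
  · refine LinearEquiv.finrank_eq (LinearEquiv.ofBijective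
      (LinearMap.codRestrict (LinearMap.ker σ) (LinearMap.codRestrict S
        (LinearMap.inr ℂ (P.obj i) (I.obj i) ∘ₗ (N.partI.space i).subtype) fun x => x.2)
        fun x => rfl) ⟨?_, ?_⟩)
    · intro x y h
      have := congr_arg (fun z => z.1.1.2) h
      exact Subtype.ext this
    · rintro ⟨⟨⟨p, x⟩, hz⟩, h0⟩
      have hp : p = 0 := h0
      subst hp
      exact ⟨⟨x, hz⟩, rfl⟩

variable {f g : V → ℕ}

/-- The point of the stratum given by a homomorphism. -/
def Stratum.ofHom (hfg : ∀ i, f i + g i = P.dim i) (b : Gr g P × Gr f I)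
    (φ : hom b.1.1.toRep b.2.1.quot) : Stratum P I f g :=
  ⟨⟨graph b.1.1 b.2.1 φ, fun i => by
    rw [← finrank_partP_add_finrank_partI, graph_partP, graph_partI, b.1.2, b.2.2, ← hfg, add_comm]⟩,
    fun i => by rw [graph_partI, b.2.2], fun i => by rw [graph_partP, b.1.2]⟩

theorem zeta_ofHom (hfg : ∀ i, f i + g i = P.dim i) (b : Gr g P × Gr f I)
    (φ : hom b.1.1.toRep b.2.1.quot) : zeta P I f g (Stratum.ofHom hfg b φ) = b :=
  Prod.ext (Subtype.ext graph_partP) (Subtype.ext graph_partI)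

theorem bijective_ofHom (hfg : ∀ i, f i + g i = P.dim i) (b : Gr g P × Gr f I) :
    Function.Bijective fun φ : hom b.1.1.toRep b.2.1.quot =>
      (⟨Stratum.ofHom hfg b φ, zeta_ofHom hfg b φ⟩ : {N : Stratum P I f g // zeta P I f g N = b}) := by
  constructor
  · intro φ ψ h
    exact graph_injective (congr_arg (fun N => N.1.1.1) h)
  · rintro ⟨N, rfl⟩
    obtain ⟨φ, hφ⟩ := exists_graph_eq N.1.1
    exact ⟨φ, Subtype.ext (Subtype.ext (Subtype.ext hφ))⟩

/-- The identification of the fibre of `ζ` with the space of homomorphisms. -/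
def fiberEquiv (hfg : ∀ i, f i + g i = P.dim i) (b : Gr g P × Gr f I) :
    {N : Stratum P I f g // zeta P I f g N = b} ≃ hom b.1.1.toRep b.2.1.quot :=
  (Equiv.ofBijective _ (bijective_ofHom hfg b)).symm

theorem fiberEquiv_symm_apply (hfg : ∀ i, f i + g i = P.dim i) (b : Gr g P × Gr f I)
    (φ : hom b.1.1.toRep b.2.1.quot) :
    ((fiberEquiv hfg b).symm φ : Stratum P I f g) = Stratum.ofHom hfg b φ := rfl

theorem mem_space_iff_fiberEquiv (hfg : ∀ i, f i + g i = P.dim i) (b : Gr g P × Gr f I)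
    (N : {N : Stratum P I f g // zeta P I f g N = b}) (i : V) (p : b.1.1.space i) (x : I.obj i) :
    ((p : P.obj i), x) ∈ N.1.1.1.space i ↔
      (fiberEquiv hfg b N).1 i p = Submodule.Quotient.mk x := by
  obtain ⟨φ, rfl⟩ := (fiberEquiv hfg b).symm.surjective N
  rw [Equiv.apply_symm_apply, fiberEquiv_symm_apply]
  exact mk_mem_graph

end Graph

end QRep

/-! ### Complements of a fixed subspace, and complements in a direct sum -/

section LinearAlgebra

variable {M : Type*} [AddCommGroup M] [Module ℂ M] {W N A : Submodule ℂ M}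

/-- The map from `A` to `N` along `W`, where `A` and `N` are complements of `W`. -/
def secAlong (W N A : Submodule ℂ M) : A →ₗ[ℂ] M :=
  (LinearMap.id - projAlong W N) ∘ₗ A.subtype

theorem secAlong_apply (x : A) : secAlong W N A x = x - projAlong W N x := rfl

theorem secAlong_mem (h : IsCompl W N) (x : A) : secAlong W N A x ∈ N :=
  sub_projAlong_mem h x

theorem secAlong_projectionOnto (h : IsCompl W N) (hA : IsCompl A W) {p : M} (hp : p ∈ N) :
    secAlong W N A (A.projectionOnto W hA p) = p := by
  have h1 : p - (A.projectionOnto W hA p : M) ∈ W := by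
    rw [Submodule.coe_projectionOnto_apply]
    exact Submodule.sub_projection_mem hA p
  have h2 : projAlong W N (A.projectionOnto W hA p : M) = A.projectionOnto W hA p - p :=
    (projAlong_eq_iff h).2 ⟨by simpa using neg_mem h1, by simpa using hp⟩
  rw [secAlong_apply, h2, sub_sub_cancel]

theorem projectionOnto_secAlong (h : IsCompl W N) (hA : IsCompl A W) (x : A) :
    A.projectionOnto W hA (secAlong W N A x) = x := by
  rw [secAlong_apply, map_sub, Submodule.projectionOnto_apply_left,
    (Submodule.projectionOnto_apply_eq_zero_iff hA).2 (projAlong_mem h _), sub_zero]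

/-- Two complements of `W` are isomorphic. -/
def secEquiv (h : IsCompl W N) (hA : IsCompl A W) : A ≃ₗ[ℂ] N :=
  LinearEquiv.ofLinearMap ((secAlong W N A).codRestrict N (secAlong_mem h))
    (A.projectionOnto W hA ∘ₗ N.subtype)
    (LinearMap.ext fun p => Subtype.ext (secAlong_projectionOnto h hA p.2))
    (LinearMap.ext fun x => projectionOnto_secAlong h hA x)

theorem range_secAlong (h : IsCompl W N) (hA : IsCompl A W) :
    LinearMap.range (secAlong W N A) = N := by
  refine le_antisymm ?_ fun p hp => ⟨_, secAlong_projectionOnto h hA hp⟩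
  rintro _ ⟨x, rfl⟩
  exact secAlong_mem h x

/-- Any extension to `E` of an isomorphism of the kernel with `ℂ^D` works. Stating this as
injectivity of `T.prod L` turns it into an open condition when `T` varies. -/
theorem LinearMap.exists_prod_injective {E F : Type*} [AddCommGroup E] [Module ℂ E]
    [AddCommGroup F] [Module ℂ F] [FiniteDimensional ℂ E] (T : E →ₗ[ℂ] F) {D : ℕ}
    (hD : Module.finrank ℂ (LinearMap.ker T) = D) :
    ∃ L : E →ₗ[ℂ] (Fin D → ℂ), Function.Injective (T.prod L) := by
  obtain ⟨π, hπ⟩ := (LinearMap.ker T).subtype.exists_leftInverse_of_injective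
    (Submodule.ker_subtype _)
  let ε := (Module.finBasisOfFinrankEq ℂ (LinearMap.ker T) hD).equivFun
  refine ⟨ε.toLinearMap ∘ₗ π, ?_⟩
  rw [← LinearMap.ker_eq_bot, LinearMap.ker_eq_bot']
  intro x hx
  have h1 : T x = 0 := congr_arg Prod.fst hx
  have h2 : ε (π x) = 0 := congr_arg Prod.snd hx
  rw [LinearEquiv.map_eq_zero_iff] at h2
  have h3 : π x = ⟨x, h1⟩ := LinearMap.congr_fun hπ ⟨x, h1⟩
  rw [h3] at h2
  exact congr_arg Subtype.val h2

variable {P I : Type*} [AddCommGroup P] [Module ℂ P] [AddCommGroup I] [Module ℂ I]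
  {WP : Submodule ℂ P} {WI : Submodule ℂ I} {N : Submodule ℂ (P × I)}

theorem isCompl_prod_of_isCompl (hP : IsCompl WP (N.map (LinearMap.fst ℂ P I)))
    (hI : IsCompl WI (N.comap (LinearMap.inr ℂ P I))) : IsCompl (WP.prod WI) N := by
  constructor
  · rw [Submodule.disjoint_def]
    rintro ⟨p, x⟩ ⟨hp, hx⟩ hN
    have hp0 : p = 0 := Submodule.disjoint_def.1 hP.disjoint p hp ⟨_, hN, rfl⟩
    subst hp0
    have hx0 : x = 0 := Submodule.disjoint_def.1 hI.disjoint x hx hN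
    rw [hx0, Prod.mk_zero_zero]
  · rw [codisjoint_iff, eq_top_iff]
    rintro ⟨p, x⟩ -
    obtain ⟨⟨a, x'⟩, hN, ha⟩ := sub_projAlong_mem hP p
    replace ha : a = p - projAlong WP _ p := ha
    have hb : ((0 : P), x - x' - projAlong WI _ (x - x')) ∈ N := sub_projAlong_mem hI (x - x')
    refine Submodule.mem_sup.2 ⟨(projAlong WP _ p, projAlong WI _ (x - x')),
      ⟨projAlong_mem hP p, projAlong_mem hI _⟩, _, add_mem hN hb, ?_⟩
    ext
    · simp [ha]
    · simp only [Prod.snd_add]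
      abel

/-- The product condition alone gives that `WP` and the image of `N` span, and that `WI` and `N ∩ I`
are disjoint; the dimension hypotheses supply the other halves. They persist along the stratum, so
the open condition on `N` passes to both parts. -/
theorem isCompl_of_isCompl_prod [FiniteDimensional ℂ P] [FiniteDimensional ℂ I]
    (h : IsCompl (WP.prod WI) N)
    (hP : Module.finrank ℂ P =
      Module.finrank ℂ WP + Module.finrank ℂ (N.map (LinearMap.fst ℂ P I)))
    (hI : Module.finrank ℂ I =
      Module.finrank ℂ WI + Module.finrank ℂ (N.comap (LinearMap.inr ℂ P I))) :
    IsCompl WP (N.map (LinearMap.fst ℂ P I)) ∧ IsCompl WI (N.comap (LinearMap.inr ℂ P I)) := by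
  constructor
  · have htop : WP ⊔ N.map (LinearMap.fst ℂ P I) = ⊤ := by
      rw [eq_top_iff]
      intro p _
      refine Submodule.mem_sup.2 ⟨_, (projAlong_mem h (p, 0)).1, _,
        ⟨_, sub_projAlong_mem h (p, 0), rfl⟩, by simp⟩
    refine ⟨?_, codisjoint_iff.2 htop⟩
    have := Submodule.finrank_sup_add_finrank_inf_eq WP (N.map (LinearMap.fst ℂ P I))
    rw [htop, finrank_top, hP, Nat.add_eq_left] at this
    rw [disjoint_iff]
    exact Submodule.finrank_eq_zero.1 this
  · rw [Submodule.isCompl_iff_disjoint _ _ hI.le, Submodule.disjoint_def]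
    intro x hx hN
    exact congr_arg Prod.snd (Submodule.disjoint_def.1 h.disjoint (0, x) ⟨WP.zero_mem, hx⟩ hN)

/-- With its companion for `I`, this shows that the coordinates of `π(N)` and `N ∩ I` are among
those of `N`, which makes `ζ` a morphism. -/
theorem fst_projAlong_prod (h : IsCompl (WP.prod WI) N)
    (hP : IsCompl WP (N.map (LinearMap.fst ℂ P I))) (p : P) :
    (projAlong (WP.prod WI) N (p, 0)).1 = projAlong WP (N.map (LinearMap.fst ℂ P I)) p :=
  ((projAlong_eq_iff hP).2 ⟨(projAlong_mem h (p, 0)).1, _, sub_projAlong_mem h (p, 0), rfl⟩).symm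

theorem snd_projAlong_prod (h : IsCompl (WP.prod WI) N)
    (hI : IsCompl WI (N.comap (LinearMap.inr ℂ P I))) (x : I) :
    (projAlong (WP.prod WI) N (0, x)).2 = projAlong WI (N.comap (LinearMap.inr ℂ P I)) x := by
  have : projAlong (WP.prod WI) N (0, x) = (0, projAlong WI (N.comap (LinearMap.inr ℂ P I)) x) := by
    refine (projAlong_eq_iff h).2 ⟨⟨WP.zero_mem, projAlong_mem hI x⟩, ?_⟩
    have : ((0 : P), x - projAlong WI _ x) ∈ N := sub_projAlong_mem hI x
    simpa using this
  rw [this]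

end LinearAlgebra

/-! ### A criterion for vector bundles -/

namespace FunSpace

theorem isVectorBundle_of_trivializations {E B : Type*} {SE : FunSpace E} {SB : FunSpace B}
    {ζ : E → B} {F : B → Type*} [∀ b, AddCommGroup (F b)] [∀ b, Module ℂ (F b)]
    {e : ∀ b, {z : E // ζ z = b} ≃ F b} {D : ℕ} (hζ : ∀ z, SE.IsMorphismAt SB ζ z)
    (h : ∀ b₀, ∃ U, IsOpen[SB.top] U ∧ b₀ ∈ U ∧ ∃ L : ∀ b, b ∈ U → F b ≃ₗ[ℂ] (Fin D → ℂ),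
      (∀ z₀ : {z : E // ζ z ∈ U}, (SE.induced Subtype.val).RegVecAt
        (fun z : {z : E // ζ z ∈ U} => L (ζ z.1) z.2 (e _ ⟨z.1, rfl⟩)) z₀) ∧
      ∀ p₀, ((SB.induced Subtype.val).prod (affine (Fin D → ℂ))).IsMorphismAt SE
        (fun p : {b : B // b ∈ U} × (Fin D → ℂ) =>
          ((e p.1).symm ((L p.1 p.1.2).symm p.2) : E)) p₀) :
    IsVectorBundle SE SB ζ F e D := by
  refine ⟨isMorphism_iff.2 hζ, fun b₀ => ?_⟩
  obtain ⟨U, hU, hb₀, L, h1, h2⟩ := h b₀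
  have hL : ∀ (b : B) (hb : b ∈ U) (z : {z : E // ζ z = b}) (h' : ζ z.1 ∈ U),
      L (ζ z.1) h' (e _ ⟨z.1, rfl⟩) = L b hb (e b z) := by
    rintro b hb ⟨z, rfl⟩ h'
    rfl
  let Φ : {z : E // ζ z ∈ U} ≃ {b : B // b ∈ U} × (Fin D → ℂ) :=
    { toFun := fun z => (⟨ζ z.1, z.2⟩, L (ζ z.1) z.2 (e _ ⟨z.1, rfl⟩))
      invFun := fun p => ⟨((e p.1).symm ((L p.1 p.1.2).symm p.2)).1, by
        rw [((e p.1).symm ((L p.1 p.1.2).symm p.2)).2]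
        exact p.1.2⟩
      left_inv := fun z => by simp
      right_inv := fun p => by
        refine Prod.ext (Subtype.ext ((e p.1).symm ((L p.1 p.1.2).symm p.2)).2) ?_
        refine (hL p.1 p.1.2 ((e p.1).symm ((L p.1 p.1.2).symm p.2)) _).trans ?_
        simp }
  refine ⟨U, hU, hb₀, Φ, ⟨isMorphism_iff.2 fun z => ?_, isMorphism_iff.2 fun p => ?_⟩,
    fun z => rfl, fun b hb => ⟨L b hb, fun z => hL b hb z _⟩⟩
  · refine isMorphismAt_prod (isMorphismAt_to_induced ?_) (isMorphismAt_affine.2 (h1 z))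
    exact (hζ z.1).comp (isMorphismAt_induced _ _ z)
  · exact isMorphismAt_to_induced (h2 p)

end FunSpace

/-! ### Homomorphisms as the kernel of a regular family of linear maps -/

namespace QRep

open FunSpace Filter

variable {V : Type v} [Quiver.{w} V] {P I : QRep.{u} V}

/-- The morphisms `A → I / B` in the charts given by complements `A₀`, `WP` and `WI`, `B`: the
deviation of a tuple of maps `A₀ → WI` from being a homomorphism. -/
def chartDiff {A₀ WP : ∀ i, Submodule ℂ (P.obj i)} (WI : ∀ i, Submodule ℂ (I.obj i))
    (hA₀ : ∀ i, IsCompl (A₀ i) (WP i)) (A : Sub P) (B : Sub I) :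
    (∀ i, A₀ i →ₗ[ℂ] WI i) →ₗ[ℂ] ∀ i j : V, (i ⟶ j) → A₀ i →ₗ[ℂ] I.obj j where
  toFun h i j a :=
    (WI j).subtype ∘ₗ h j ∘ₗ (A₀ j).projectionOnto (WP j) (hA₀ j) ∘ₗ P.map a ∘ₗ
      secAlong (WP i) (A.space i) (A₀ i) -
    projAlong (WI j) (B.space j) ∘ₗ I.map a ∘ₗ (WI i).subtype ∘ₗ h i
  map_add' h h' := by
    ext i j a x
    simp
    abel
  map_smul' c h := by
    ext i j a x
    simp [smul_sub]

/-- The coordinates of a homomorphism `A → I / B`. -/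
def chartEquiv {A₀ WP : ∀ i, Submodule ℂ (P.obj i)} {WI : ∀ i, Submodule ℂ (I.obj i)}
    (hA₀ : ∀ i, IsCompl (A₀ i) (WP i)) {A : Sub P} {B : Sub I}
    (hA : ∀ i, IsCompl (WP i) (A.space i)) (hB : ∀ i, IsCompl (WI i) (B.space i)) :
    (∀ i, A₀ i →ₗ[ℂ] WI i) ≃ₗ[ℂ] ∀ i, A.toRep.obj i →ₗ[ℂ] B.quot.obj i :=
  LinearEquiv.piCongrRight fun i => LinearEquiv.arrowCongr (secEquiv (hA i) (hA₀ i))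
    ((B.space i).quotientEquivOfIsCompl (WI i) (hB i).symm).symm

section Chart

variable {A₀ WP : ∀ i, Submodule ℂ (P.obj i)} {WI : ∀ i, Submodule ℂ (I.obj i)}
  (hA₀ : ∀ i, IsCompl (A₀ i) (WP i)) {A : Sub P} {B : Sub I}
  (hA : ∀ i, IsCompl (WP i) (A.space i)) (hB : ∀ i, IsCompl (WI i) (B.space i))

theorem chartEquiv_apply (h : ∀ i, A₀ i →ₗ[ℂ] WI i) (i : V) (x : A₀ i) :
    chartEquiv hA₀ hA hB h i (secEquiv (hA i) (hA₀ i) x) =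
      (Submodule.Quotient.mk (h i x : I.obj i) : I.obj i ⧸ B.space i) := by
  change ((B.space i).quotientEquivOfIsCompl (WI i) (hB i).symm).symm
    (h i ((secEquiv (hA i) (hA₀ i)).symm (secEquiv (hA i) (hA₀ i) x))) = _
  rw [LinearEquiv.symm_apply_apply, LinearEquiv.symm_apply_eq]
  exact (Submodule.quotientEquivOfIsCompl_apply_mk_right _ _).symm

/-- Commuting with an arrow is an equality in `I/B`. Each class there has a unique representative in
`WI`, found by projecting along `B`, so the equality becomes one between elements of `WI`. -/
theorem chartEquiv_mem_hom_iff (h : ∀ i, A₀ i →ₗ[ℂ] WI i) :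
    chartEquiv hA₀ hA hB h ∈ hom A.toRep B.quot ↔ chartDiff WI hA₀ A B h = 0 := by
  have key : ∀ (i j : V) (a : i ⟶ j) (x : A₀ i),
      chartEquiv hA₀ hA hB h j (A.toRep.map a (secEquiv (hA i) (hA₀ i) x)) =
        B.quot.map a (chartEquiv hA₀ hA hB h i (secEquiv (hA i) (hA₀ i) x)) ↔
      chartDiff WI hA₀ A B h i j a x = 0 := by
    intro i j a x
    set p : A.space j := A.toRep.map a (secEquiv (hA i) (hA₀ i) x) with hp
    have hpx : (p : P.obj j) = P.map a (secAlong (WP i) (A.space i) (A₀ i) x) := rfl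
    have h1 : p = secEquiv (hA j) (hA₀ j) ((A₀ j).projectionOnto (WP j) (hA₀ j) p) :=
      Subtype.ext (secAlong_projectionOnto (hA j) (hA₀ j) p.2).symm
    rw [h1, chartEquiv_apply, chartEquiv_apply]
    change _ = (Submodule.Quotient.mk (I.map a (h i x)) : I.obj j ⧸ B.space j) ↔ _
    rw [Submodule.Quotient.eq]
    have h2 : chartDiff WI hA₀ A B h i j a x =
      (h j ((A₀ j).projectionOnto (WP j) (hA₀ j) p) : I.obj j) -
        projAlong (WI j) (B.space j) (I.map a (h i x)) := rfl
    rw [h2, sub_eq_zero, eq_comm, projAlong_eq_iff (hB j), ← neg_mem_iff, neg_sub]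
    exact (and_iff_right (Submodule.coe_mem _)).symm
  constructor
  · intro hh
    ext i j a x
    exact (key i j a x).1 (hh i j a _)
  · intro hh i j a p
    obtain ⟨x, rfl⟩ := (secEquiv (hA i) (hA₀ i)).surjective p
    exact (key i j a x).2 (by rw [hh]; rfl)

theorem map_ker_chartDiff :
    (LinearMap.ker (chartDiff WI hA₀ A B)).map (chartEquiv hA₀ hA hB).toLinearMap =
      hom A.toRep B.quot := by
  ext φ
  obtain ⟨h, rfl⟩ := (chartEquiv hA₀ hA hB).surjective φ
  rw [chartEquiv_mem_hom_iff]
  constructor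
  · rintro ⟨h', hh', he⟩
    rwa [← (chartEquiv hA₀ hA hB).injective he]
  · exact fun hh => ⟨h, hh, rfl⟩

theorem finrank_ker_chartDiff (hA : ∀ i, IsCompl (WP i) (A.space i))
    (hB : ∀ i, IsCompl (WI i) (B.space i)) :
    Module.finrank ℂ (LinearMap.ker (chartDiff WI hA₀ A B)) =
      Module.finrank ℂ (hom A.toRep B.quot) := by
  rw [← map_ker_chartDiff hA₀ hA hB]
  exact (LinearEquiv.finrank_map_eq (chartEquiv hA₀ hA hB) _).symm

/-- The trivialization of `Hom(A, I / B)` over a chart. -/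
def chartTrivialization [Finite V] {D : ℕ} (hD : Module.finrank ℂ (hom A.toRep B.quot) = D)
    {L : (∀ i, A₀ i →ₗ[ℂ] WI i) →ₗ[ℂ] (Fin D → ℂ)}
    (hL : Function.Injective ((chartDiff WI hA₀ A B).prod L)) :
    hom A.toRep B.quot ≃ₗ[ℂ] (Fin D → ℂ) :=
  LinearMap.linearEquivOfInjective
    (L ∘ₗ (chartEquiv hA₀ hA hB).symm.toLinearMap ∘ₗ (hom A.toRep B.quot).subtype)
    (by
      rw [← LinearMap.ker_eq_bot, LinearMap.ker_eq_bot']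
      intro φ hφ
      have h1 : chartDiff WI hA₀ A B ((chartEquiv hA₀ hA hB).symm φ.1) = 0 := by
        rw [← chartEquiv_mem_hom_iff hA₀ hA hB, LinearEquiv.apply_symm_apply]
        exact φ.2
      have h2 : (chartEquiv hA₀ hA hB).symm φ.1 = 0 :=
        hL (Prod.ext (by simp [h1]) (by simpa using hφ))
      exact Subtype.ext ((LinearEquiv.map_eq_zero_iff _).1 h2))
    (by rw [hD, Module.finrank_fin_fun])

theorem chartTrivialization_apply [Finite V] {D : ℕ}
    (hD : Module.finrank ℂ (hom A.toRep B.quot) = D)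
    {L : (∀ i, A₀ i →ₗ[ℂ] WI i) →ₗ[ℂ] (Fin D → ℂ)}
    (hL : Function.Injective ((chartDiff WI hA₀ A B).prod L)) (φ : hom A.toRep B.quot) :
    chartTrivialization hA₀ hA hB hD hL φ = L ((chartEquiv hA₀ hA hB).symm φ.1) := rfl

theorem chartTrivialization_symm [Finite V] {D : ℕ}
    (hD : Module.finrank ℂ (hom A.toRep B.quot) = D)
    {L : (∀ i, A₀ i →ₗ[ℂ] WI i) →ₗ[ℂ] (Fin D → ℂ)}
    (hL : Function.Injective ((chartDiff WI hA₀ A B).prod L)) (c : Fin D → ℂ) :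
    L ((chartEquiv hA₀ hA hB).symm ((chartTrivialization hA₀ hA hB hD hL).symm c).1) = c :=
  (chartTrivialization hA₀ hA hB hD hL).apply_symm_apply c

theorem chartDiff_symm_hom (φ : hom A.toRep B.quot) :
    chartDiff WI hA₀ A B ((chartEquiv hA₀ hA hB).symm φ.1) = 0 := by
  rw [← chartEquiv_mem_hom_iff hA₀ hA hB, LinearEquiv.apply_symm_apply]
  exact φ.2

theorem hom_apply_secEquiv (φ : hom A.toRep B.quot) (i : V) (x : A₀ i) :
    φ.1 i (secEquiv (hA i) (hA₀ i) x) = (Submodule.Quotient.mk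
      ((chartEquiv hA₀ hA hB).symm φ.1 i x : I.obj i) : I.obj i ⧸ B.space i) := by
  rw [← chartEquiv_apply hA₀ hA hB, LinearEquiv.apply_symm_apply]

end Chart

/-! ### Regularity of the coordinates and of `ζ` -/

section Regular

variable {f g : V → ℕ}

/-- The product of two quiver Grassmannians. -/
abbrev baseSpace (P I : QRep.{u} V) (f g : V → ℕ) : FunSpace (Gr g P × Gr f I) :=
  (Gr.funSpace g P).prod (Gr.funSpace f I)

theorem isMorphismAt_base_fst (b : Gr g P × Gr f I) :
    (baseSpace P I f g).IsMorphismAt (GradedGr.funSpace g P)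
      (fun b => ⟨b.1.1.space, b.1.2⟩) b :=
  (isMorphismAt_induced _ _ b.1).comp (isMorphismAt_fst _ _ b)

theorem isMorphismAt_base_snd (b : Gr g P × Gr f I) :
    (baseSpace P I f g).IsMorphismAt (GradedGr.funSpace f I)
      (fun b => ⟨b.2.1.space, b.2.2⟩) b :=
  (isMorphismAt_induced _ _ b.2).comp (isMorphismAt_snd _ _ b)

theorem regVecAt_projAlong_fst (b : Gr g P × Gr f I) {i : V} {W : Submodule ℂ (P.obj i)}
    (h : IsCompl W (b.1.1.space i)) (x : P.obj i) :
    (baseSpace P I f g).RegVecAt (fun b => projAlong W (b.1.1.space i) x) b :=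
  RegVecAt.comp (GradedGr.regVecAt_projAlong ⟨b.1.1.space, b.1.2⟩ h x) (isMorphismAt_base_fst b)

theorem regVecAt_projAlong_snd (b : Gr g P × Gr f I) {i : V} {W : Submodule ℂ (I.obj i)}
    (h : IsCompl W (b.2.1.space i)) (x : I.obj i) :
    (baseSpace P I f g).RegVecAt (fun b => projAlong W (b.2.1.space i) x) b :=
  RegVecAt.comp (GradedGr.regVecAt_projAlong ⟨b.2.1.space, b.2.2⟩ h x) (isMorphismAt_base_snd b)

theorem regVecAt_chartDiff [Finite V] [∀ i j : V, Finite (i ⟶ j)] (b : Gr g P × Gr f I)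
    {A₀ WP : ∀ i, Submodule ℂ (P.obj i)} {WI : ∀ i, Submodule ℂ (I.obj i)}
    (hA₀ : ∀ i, IsCompl (A₀ i) (WP i)) (hA : ∀ i, IsCompl (WP i) (b.1.1.space i))
    (hB : ∀ i, IsCompl (WI i) (b.2.1.space i)) (h : ∀ i, A₀ i →ₗ[ℂ] WI i) :
    (baseSpace P I f g).RegVecAt (fun b => chartDiff WI hA₀ b.1.1 b.2.1 h) b := by
  refine RegVecAt.pi fun i => RegVecAt.pi fun j => RegVecAt.pi fun a => RegVecAt.linearMap fun x =>
    RegVecAt.sub ?_ (regVecAt_projAlong_snd b (hB j) _)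
  exact ((regVecAt_const _ (x : P.obj i) b).sub (regVecAt_projAlong_fst b (hA i) x)).map
    ((WI j).subtype ∘ₗ h j ∘ₗ (A₀ j).projectionOnto (WP j) (hA₀ j) ∘ₗ P.map a)

/-- A point of the stratum as a point of the product of Grassmannians. -/
def Stratum.toGradedGr (N : Stratum P I f g) : GradedGr P.dim (P.sum I) :=
  ⟨N.1.1.space, N.1.2⟩

/-- The subspace of `Pᵢ × Iᵢ` of a point of the stratum. -/
def Stratum.space (N : Stratum P I f g) (i : V) : Submodule ℂ (P.obj i × I.obj i) :=
  N.1.1.space i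

theorem Stratum.isMorphismAt_toGradedGr (N : Stratum P I f g) :
    (Stratum.funSpace P I f g).IsMorphismAt (GradedGr.funSpace P.dim (P.sum I))
      Stratum.toGradedGr N :=
  (isMorphismAt_induced _ _ N.1).comp (isMorphismAt_induced _ _ N)

theorem Stratum.isMorphismAt_to {Z : Type*} {S : FunSpace Z} {φ : Z → Stratum P I f g} {z : Z}
    (h : S.IsMorphismAt (GradedGr.funSpace P.dim (P.sum I)) (fun y => (φ y).toGradedGr) z) :
    S.IsMorphismAt (Stratum.funSpace P I f g) φ z :=
  isMorphismAt_to_induced (isMorphismAt_to_induced h)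

theorem Stratum.regVecAt_projAlong (N : Stratum P I f g) {i : V}
    {W : Submodule ℂ (P.obj i × I.obj i)} (h : IsCompl W (N.space i)) (z : P.obj i × I.obj i) :
    (Stratum.funSpace P I f g).RegVecAt (fun N => projAlong W (N.space i) z) N :=
  RegVecAt.comp (GradedGr.regVecAt_projAlong N.toGradedGr h z) N.isMorphismAt_toGradedGr

theorem Stratum.eventually_isCompl [Finite V] (N : Stratum P I f g)
    {W : ∀ i, Submodule ℂ (P.obj i × I.obj i)} (h : ∀ i, IsCompl (W i) (N.space i)) :
    ∀ᶠ N' in (Stratum.funSpace P I f g).nhd N, ∀ i, IsCompl (W i) (N'.space i) :=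
  N.isMorphismAt_toGradedGr.tendsto (GradedGr.eventually_isCompl N.toGradedGr h)

theorem Stratum.isCompl_parts (N : Stratum P I f g) {i : V} {WP : Submodule ℂ (P.obj i)}
    {WI : Submodule ℂ (I.obj i)} (hP : Module.finrank ℂ (P.obj i) = Module.finrank ℂ WP + g i)
    (hI : Module.finrank ℂ (I.obj i) = Module.finrank ℂ WI + f i)
    (h : IsCompl (WP.prod WI) (N.space i)) :
    IsCompl WP (N.1.1.partP.space i) ∧ IsCompl WI (N.1.1.partI.space i) :=
  isCompl_of_isCompl_prod h (by rw [hP, ← N.2.2 i]; rfl) (by rw [hI, ← N.2.1 i]; rfl)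

/-- For `N'` near `N`, the parts of `N'` are the images of the parts of `N` under `secAlong`, whose
coefficients are blocks of the projection along `N'`. -/
theorem isMorphismAt_zeta [Finite V] (N : Stratum P I f g) :
    (Stratum.funSpace P I f g).IsMorphismAt (baseSpace P I f g) (zeta P I f g) N := by
  choose WP hWP using fun i => (N.1.1.partP.space i).exists_isCompl
  choose WI hWI using fun i => (N.1.1.partI.space i).exists_isCompl
  have hN : ∀ i, IsCompl ((WP i).prod (WI i)) (N.space i) := fun i =>
    isCompl_prod_of_isCompl (hWP i).symm (hWI i).symm
  have hev := (N.eventually_isCompl hN).mono fun N' h i => And.intro (h i) <|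
    N'.isCompl_parts
      (by rw [← N.2.2 i, Submodule.finrank_add_eq_of_isCompl (hWP i).symm])
      (by rw [← N.2.1 i, Submodule.finrank_add_eq_of_isCompl (hWI i).symm]) (h i)
  refine isMorphismAt_prod (isMorphismAt_to_induced ?_) (isMorphismAt_to_induced ?_)
  · refine GradedGr.isMorphismAt_of_range (E := fun i => N.1.1.partP.space i) N.2.2
      (G := fun N' i => secAlong (WP i) (N'.1.1.partP.space i) (N.1.1.partP.space i))
      (fun i x => ?_) (hev.mono fun N' h i => range_secAlong (h i).2.1 (hWP i))
    refine (regVecAt_const _ (x : P.obj i) N).sub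
      (((N.regVecAt_projAlong (hN i) (x, 0)).map (LinearMap.fst ℂ _ _)).congr ?_)
    exact hev.mono fun N' h => fst_projAlong_prod (h i).1 (h i).2.1 x
  · refine GradedGr.isMorphismAt_of_range (E := fun i => N.1.1.partI.space i) N.2.1
      (G := fun N' i => secAlong (WI i) (N'.1.1.partI.space i) (N.1.1.partI.space i))
      (fun i x => ?_) (hev.mono fun N' h i => range_secAlong (h i).2.2 (hWI i))
    refine (regVecAt_const _ (x : I.obj i) N).sub
      (((N.regVecAt_projAlong (hN i) (0, x)).map (LinearMap.snd ℂ _ _)).congr ?_)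
    exact hev.mono fun N' h => snd_projAlong_prod (h i).1 (h i).2.2 x

end Regular

/-! ### Local triviality -/

section Bundle

variable {f g : V → ℕ}

/-- Parametrizes the graph by the fixed space `A₀ × B₀`, so that the inverse of a trivialization can
be recognized as a morphism into the Grassmannian. -/
theorem range_graph {A₀ WP : ∀ i, Submodule ℂ (P.obj i)} {B₀ WI : ∀ i, Submodule ℂ (I.obj i)}
    (hA₀ : ∀ i, IsCompl (A₀ i) (WP i)) (hB₀ : ∀ i, IsCompl (B₀ i) (WI i)) {A : Sub P} {B : Sub I}
    (hA : ∀ i, IsCompl (WP i) (A.space i)) (hB : ∀ i, IsCompl (WI i) (B.space i))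
    (φ : hom A.toRep B.quot) (i : V) :
    LinearMap.range ((secAlong (WP i) (A.space i) (A₀ i) ∘ₗ LinearMap.fst ℂ _ _).prod
      (((WI i).subtype ∘ₗ (chartEquiv hA₀ hA hB).symm φ.1 i).coprod
        (secAlong (WI i) (B.space i) (B₀ i)))) = (graph A B φ).space i := by
  ext z
  constructor
  · rintro ⟨⟨x, y⟩, rfl⟩
    refine ⟨secEquiv (hA i) (hA₀ i) x, rfl, ?_⟩
    rw [hom_apply_secEquiv hA₀ hA hB]
    refine (Submodule.Quotient.eq _).2 ?_
    have : (((chartEquiv hA₀ hA hB).symm φ.1 i x : WI i) : I.obj i) -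
        ((((chartEquiv hA₀ hA hB).symm φ.1 i x : WI i) : I.obj i) +
          secAlong (WI i) (B.space i) (B₀ i) y) ∈ B.space i := by
      rw [sub_add_cancel_left]
      exact neg_mem (secAlong_mem (hB i) y)
    exact this
  · obtain ⟨p, z⟩ := z
    rintro ⟨q, hq, h⟩
    obtain ⟨x, rfl⟩ := (secEquiv (hA i) (hA₀ i)).surjective q
    rw [hom_apply_secEquiv hA₀ hA hB] at h
    have h1 := neg_mem ((Submodule.Quotient.eq _).1 h)
    rw [neg_sub, ← range_secAlong (hB i) (hB₀ i)] at h1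
    obtain ⟨y, hy⟩ := h1
    refine ⟨(x, y), Prod.ext hq ?_⟩
    change _ + secAlong (WI i) (B.space i) (B₀ i) y = z
    rw [hy]
    exact add_sub_cancel _ _

/-- If `h` is the coordinate tuple and `w` the `WP`-component of `x`, then `(x - w, h x)` lies in
`N`. So `(x, 0)` splits as `(w, -h x)` plus an element of `N`, and `h` is read off from a projection
that is regular in `N`. -/
theorem chartEquiv_symm_fiberEquiv (hfg : ∀ i, f i + g i = P.dim i)
    {A₀ WP : ∀ i, Submodule ℂ (P.obj i)} {WI : ∀ i, Submodule ℂ (I.obj i)}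
    (hA₀ : ∀ i, IsCompl (A₀ i) (WP i)) (N : Stratum P I f g)
    (hA : ∀ i, IsCompl (WP i) (N.1.1.partP.space i))
    (hB : ∀ i, IsCompl (WI i) (N.1.1.partI.space i)) (i : V) (x : A₀ i) :
    ((chartEquiv hA₀ hA hB).symm (fiberEquiv hfg (zeta P I f g N) ⟨N, rfl⟩).1 i x : I.obj i) =
      -(projAlong ((WP i).prod (WI i)) (N.space i) ((x : P.obj i), (0 : I.obj i))).2 := by
  set φ := fiberEquiv hfg (zeta P I f g N) ⟨N, rfl⟩
  have h1 := hom_apply_secEquiv hA₀ hA hB φ i x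
  have h2 : ((secAlong (WP i) (N.1.1.partP.space i) (A₀ i) x : P.obj i),
      ((chartEquiv hA₀ hA hB).symm φ.1 i x : I.obj i)) ∈ N.space i :=
    (mem_space_iff_fiberEquiv hfg (zeta P I f g N) ⟨N, rfl⟩ i
      (secEquiv (hA i) (hA₀ i) x) _).2 h1
  have h3 : projAlong ((WP i).prod (WI i)) (N.space i) ((x : P.obj i), (0 : I.obj i)) =
      (projAlong (WP i) (N.1.1.partP.space i) x,
        -((chartEquiv hA₀ hA hB).symm φ.1 i x : I.obj i)) := by
    refine (projAlong_eq_iff (isCompl_prod_of_isCompl (hA i) (hB i))).2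
      ⟨⟨projAlong_mem (hA i) x, neg_mem (Submodule.coe_mem _)⟩, ?_⟩
    rw [Prod.mk_sub_mk, zero_sub, neg_neg]
    exact h2
  rw [h3, neg_neg]

/-- The part of a chart of the base over which a linear map `L` trivializes the bundle. -/
def trivialLocus {A₀ WP : ∀ i, Submodule ℂ (P.obj i)} {WI : ∀ i, Submodule ℂ (I.obj i)}
    (hA₀ : ∀ i, IsCompl (A₀ i) (WP i)) {D : ℕ}
    (L : (∀ i, A₀ i →ₗ[ℂ] WI i) →ₗ[ℂ] (Fin D → ℂ)) : Set (Gr g P × Gr f I) :=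
  {b | (∀ i, IsCompl (WP i) (b.1.1.space i)) ∧ (∀ i, IsCompl (WI i) (b.2.1.space i)) ∧
    Function.Injective ((chartDiff WI hA₀ b.1.1 b.2.1).prod L)}

section

variable [Finite V] [∀ i j : V, Finite (i ⟶ j)]
  {A₀ WP : ∀ i, Submodule ℂ (P.obj i)} {WI : ∀ i, Submodule ℂ (I.obj i)}
  (hA₀ : ∀ i, IsCompl (A₀ i) (WP i)) {D : ℕ} (L : (∀ i, A₀ i →ₗ[ℂ] WI i) →ₗ[ℂ] (Fin D → ℂ))

theorem regVecAt_chartDiff_prod {b : Gr g P × Gr f I} (hb : b ∈ trivialLocus hA₀ L)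
    (h : ∀ i, A₀ i →ₗ[ℂ] WI i) :
    (baseSpace P I f g).RegVecAt (fun b => (chartDiff WI hA₀ b.1.1 b.2.1).prod L h) b :=
  (regVecAt_chartDiff b hA₀ hb.1 hb.2.1 h).prodMk (regVecAt_const _ (L h) b)

theorem isOpen_trivialLocus :
    IsOpen[(baseSpace P I f g).top] (trivialLocus hA₀ L : Set (Gr g P × Gr f I)) := by
  refine isOpen_of_nhd fun b hb => ?_
  filter_upwards [
    (isMorphismAt_base_fst b).tendsto (GradedGr.eventually_isCompl ⟨b.1.1.space, b.1.2⟩ hb.1),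
    (isMorphismAt_base_snd b).tendsto (GradedGr.eventually_isCompl ⟨b.2.1.space, b.2.2⟩ hb.2.1),
    eventually_injective (regVecAt_chartDiff_prod hA₀ L hb) hb.2.2] with b' h1 h2 h3
  exact ⟨h1, h2, h3⟩

end

theorem isVectorBundle_zeta [Finite V] [∀ i j : V, Finite (i ⟶ j)]
    (hfg : ∀ i, f i + g i = P.dim i) {D : ℕ}
    (hD : ∀ b : Gr g P × Gr f I, Module.finrank ℂ (hom b.1.1.toRep b.2.1.quot) = D) :
    IsVectorBundle (Stratum.funSpace P I f g) ((Gr.funSpace g P).prod (Gr.funSpace f I))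
      (zeta P I f g) (fun b => hom b.1.1.toRep b.2.1.quot) (fiberEquiv hfg) D := by
  refine isVectorBundle_of_trivializations isMorphismAt_zeta fun b₀ => ?_
  choose WP hWP using fun i => (b₀.1.1.space i).exists_isCompl
  choose WI hWI using fun i => (b₀.2.1.space i).exists_isCompl
  -- The subspaces of `b₀` themselves serve as the reference complements `A₀` and `B₀`.
  obtain ⟨L, hL⟩ := (chartDiff WI hWP b₀.1.1 b₀.2.1).exists_prod_injective
    ((finrank_ker_chartDiff hWP (fun i => (hWP i).symm) (fun i => (hWI i).symm)).trans (hD b₀))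
  refine ⟨trivialLocus hWP L, isOpen_trivialLocus hWP L,
    ⟨fun i => (hWP i).symm, fun i => (hWI i).symm, hL⟩,
    fun b hb => chartTrivialization hWP hb.1 hb.2.1 (hD b) hb.2.2, fun N => ?_, fun p => ?_⟩
  · simp only [chartTrivialization_apply]
    refine RegVecAt.map (RegVecAt.pi fun i => RegVecAt.linearMap fun x =>
      RegVecAt.of_injective (WI i).subtype (WI i).injective_subtype ?_) L
    have h1 : (Stratum.funSpace P I f g).RegVecAt (fun N =>
        -(projAlong ((WP i).prod (WI i)) (N.space i) ((x : P.obj i), (0 : I.obj i))).2) N.1 :=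
      ((N.1.regVecAt_projAlong (isCompl_prod_of_isCompl (N.2.1 i) (N.2.2.1 i)) _).map
        (LinearMap.snd ℂ _ _)).neg
    have h2 := RegVecAt.comp h1 (isMorphismAt_induced Subtype.val _ N)
    refine h2.congr (Eventually.of_forall fun N' => ?_)
    exact (chartEquiv_symm_fiberEquiv hfg hWP N'.1 N'.2.1 N'.2.2.1 i x).symm
  · let U := {b : Gr g P × Gr f I // b ∈ trivialLocus hWP L}
    let S := ((baseSpace P I f g).induced (Subtype.val : U → _)).prod
      (affine (Fin D → ℂ))
    let τ : ∀ q : U × (Fin D → ℂ), hom q.1.1.1.1.toRep q.1.1.2.1.quot := fun q =>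
      (chartTrivialization hWP q.1.2.1 q.1.2.2.1 (hD q.1) q.1.2.2.2).symm q.2
    let h : U × (Fin D → ℂ) → ∀ i, b₀.1.1.space i →ₗ[ℂ] WI i := fun q =>
      (chartEquiv hWP q.1.2.1 q.1.2.2.1).symm (τ q).1
    let π : U × (Fin D → ℂ) → Gr g P × Gr f I := fun q => q.1.1
    have hbase : S.IsMorphismAt (baseSpace P I f g) π p :=
      (isMorphismAt_induced _ _ p.1).comp (isMorphismAt_fst _ _ p)
    -- The coordinates of the homomorphism with trivialization `c` are the unique solution of
    -- `chartDiff h = 0`, `L h = c`, an injective system with regular coefficients.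
    have hreg : S.RegVecAt h p := by
      refine RegVecAt.of_apply
        (A := fun q : U × (Fin D → ℂ) =>
          (chartDiff WI hWP q.1.1.1.1 q.1.1.2.1).prod L)
        (ψ := fun q => (0, q.2))
        (fun k => RegVecAt.comp (ψ := π) (regVecAt_chartDiff_prod hWP L p.1.2 k) hbase) p.1.2.2.2
        ((regVecAt_const _ _ _).prodMk (isMorphismAt_affine.1 (isMorphismAt_snd _ _ p)))
        (Eventually.of_forall fun q => Prod.ext ?_ ?_)
      · exact chartDiff_symm_hom hWP q.1.2.1 q.1.2.2.1 (τ q)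
      · exact chartTrivialization_symm hWP q.1.2.1 q.1.2.2.1 (hD q.1) q.1.2.2.2 q.2
    refine Stratum.isMorphismAt_to (GradedGr.isMorphismAt_of_range
      (E := fun i => b₀.1.1.space i × b₀.2.1.space i) (fun i => ?_)
      (G := fun q i => (secAlong (WP i) (q.1.1.1.1.space i) (b₀.1.1.space i) ∘ₗ
        LinearMap.fst ℂ _ _).prod (((WI i).subtype ∘ₗ h q i).coprod
          (secAlong (WI i) (q.1.1.2.1.space i) (b₀.2.1.space i)))) ?_
      (Eventually.of_forall fun q i => range_graph hWP hWI q.1.2.1 q.1.2.2.1 (τ q) i))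
    · rw [Module.finrank_prod, b₀.1.2, b₀.2.2, ← hfg, add_comm]
    · rintro i ⟨x, y⟩
      refine RegVecAt.prodMk (E := P.obj i) (F := I.obj i) ?_ (RegVecAt.add ?_ ?_)
      · exact (regVecAt_const _ (x : P.obj i) p).sub
          (RegVecAt.comp (ψ := π) (regVecAt_projAlong_fst p.1.1 (p.1.2.1 i) x) hbase)
      · exact hreg.map ((WI i).subtype ∘ₗ LinearMap.applyₗ x ∘ₗ LinearMap.proj i)
      · exact (regVecAt_const _ (y : I.obj i) p).sub
          (RegVecAt.comp (ψ := π) (regVecAt_projAlong_snd p.1.1 (p.1.2.2.1 i) y) hbase)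

end Bundle

end QRep

end

/-! ### The theorem -/

theorem mainTheorem4 {V : Type v} [Quiver.{w} V] [Fintype V] [∀ i j : V, Fintype (i ⟶ j)]
    (P I : QRep.{u} V) (hP : P.IsProjective) (hI : I.IsInjective)
    (f g : V → ℕ) (hfg : ∀ i, f i + g i = P.dim i) :
    Function.Surjective (QRep.zeta P I f g) ∧
    ∃ D : ℕ,
      (∀ b : QRep.Gr g P × QRep.Gr f I,
        Module.finrank ℂ (QRep.hom b.1.1.toRep b.2.1.quot) = D ∧
        (D : ℤ) = QRep.euler (fun i => (P.dim i : ℤ) - f i) (fun i => (I.dim i : ℤ) - f i)) ∧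
      ∃ e : ∀ b : QRep.Gr g P × QRep.Gr f I,
          {N : QRep.Stratum P I f g // QRep.zeta P I f g N = b} ≃
            QRep.hom b.1.1.toRep b.2.1.quot,
        (∀ b N i (p : b.1.1.space i) (x : I.obj i),
          ((p : P.obj i), x) ∈ N.1.1.1.space i ↔
            (e b N).1 i p = Submodule.Quotient.mk x) ∧
        FunSpace.IsVectorBundle (QRep.Stratum.funSpace P I f g)
          ((QRep.Gr.funSpace g P).prod (QRep.Gr.funSpace f I)) (QRep.zeta P I f g)
          (fun b => QRep.hom b.1.1.toRep b.2.1.quot) e D := by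
  have hdim : ∀ b : QRep.Gr g P × QRep.Gr f I,
      (Module.finrank ℂ (QRep.hom b.1.1.toRep b.2.1.quot) : ℤ) =
        QRep.euler (fun i => (P.dim i : ℤ) - f i) (fun i => (I.dim i : ℤ) - f i) := by
    intro b
    rw [QRep.finrank_hom_sub_quot hI]
    congr 1 <;> funext i
    · rw [b.1.2, ← hfg]
      simp
    · rw [b.2.2]
  -- Taking `toNat` defines `D` without a base point, so the argument also covers an empty base; at
  -- any point `hdim` shows that nothing is truncated.
  have hD : ∀ b : QRep.Gr g P × QRep.Gr f I,
      Module.finrank ℂ (QRep.hom b.1.1.toRep b.2.1.quot) =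
        (QRep.euler (fun i => (P.dim i : ℤ) - f i) (fun i => (I.dim i : ℤ) - f i)).toNat :=
    fun b => by rw [← hdim b, Int.toNat_natCast]
  -- The preimage of `(N_P, N_I)` is the graph of zero, which is `N_P ⊕ N_I`.
  refine ⟨fun b => ⟨_, QRep.zeta_ofHom hfg b 0⟩, _, fun b => ⟨hD b, ?_⟩, QRep.fiberEquiv hfg,
    QRep.mem_space_iff_fiberEquiv hfg, QRep.isVectorBundle_zeta hfg hD⟩
  rw [← hD b, hdim b]
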